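/- Let $n\ge 1$, $n\ne 2$ (so that $\mathfrak{so}(n)$ is semisimple), and let $\mathfrak g=\mathfrak{so}(n)$ be the Lie algebra of real skew-symmetric $n\times n$ matrices, with complexification $\mathfrak g^{\mathbb C}=\mathbb C\otimes_{\mathbb R}\mathfrak g$. A subalgebra $\mathfrak q\le\mathfrak g^{\mathbb C}$ is *parabolic* if it contains a maximal solvable subalgebra of $\mathfrak g^{\mathbb C}$; let $\mathfrak n=\mathfrak q^{\perp}$ be its polar for the Killing form (its nilradical), and let $\mathfrak n^{(1)}=\mathfrak n$, $\mathfrak n^{(r+1)}=[\mathfrak n,\mathfrak n^{(r)}]$ for $r\ge 1$. For $\xi\in\mathfrak g$ and $r\in\mathbb Z$ let $\mathfrak g_r\le\mathfrak g^{\mathbb C}$ be the $\mathrm i r$-eigenspace of $\operatorname{ad}\xi$ ($\{0\}$ if $\mathrm i r$ is not an eigenvalue). The element $\xi$ is *canonical* if there is a parabolic subalgebra $\mathfrak q\le\mathfrak g^{\mathbb C}$ such that the eigenvalues of $\operatorname{ad}\xi$ on $\mathfrak g^{\mathbb C}$ lie in $\mathrm i\mathbb Z$, $\mathfrak q=\sum_{i\ge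 0}\mathfrak g_i$, and $\mathfrak n^{(r)}=\sum_{i\ge r}\mathfrak g_i$ for all $r\ge 1$. Then $\xi\in\mathfrak{so}(n)$ is canonical if and only if one of the following holds, where $\xi$ is regarded as an endomorphism of $\mathbb C^n$: (a) for some integer $k\ge 0$, the set of eigenvalues of $\xi$ is exactly $\{\pm\mathrm i j : j\in\mathbb Z,\ 0\le j\le k\}$; (b) for some integer $k\ge 0$, the set of eigenvalues of $\xi$ is exactly $\{\pm\mathrm i(j+\tfrac12) : j\in\mathbb Z,\ 0\le j\le k\}$, and each of the eigenvalues $\tfrac12\mathrm i$ and $-\tfrac12\mathrm i$ has multiplicity at least $2$. -/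

import Mathlib

open scoped TensorProduct

namespace CanonicalElement

variable {L : Type*} [LieRing L] [LieAlgebra ℂ L]

/-- A Borel subalgebra of a complex Lie algebra: a maximal solvable subalgebra. -/
def IsBorel (b : LieSubalgebra ℂ L) : Prop :=
  Maximal (fun s : LieSubalgebra ℂ L => LieAlgebra.IsSolvable s) b

/-- A parabolic subalgebra: a subalgebra containing a maximal solvable subalgebra. -/
def IsParabolic (q : LieSubalgebra ℂ L) : Prop :=
  ∃ b : LieSubalgebra ℂ L, IsBorel b ∧ b ≤ q

/-- The polar `q^⊥` of a subalgebra with respect to the Killing form. For a parabolic subalgebra of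
a semisimple Lie algebra this is its nilradical. -/
noncomputable def polar (q : LieSubalgebra ℂ L) : Submodule ℂ L :=
  LinearMap.BilinForm.orthogonal (killingForm ℂ L) q.toSubmodule

/-- The linear span `[A, B]` of all brackets of elements of `A` with elements of `B`. -/
def bracketSpan (A B : Submodule ℂ L) : Submodule ℂ L :=
  Submodule.span ℂ {z : L | ∃ a ∈ A, ∃ b ∈ B, ⁅a, b⁆ = z}

/-- The central descending series, indexed from zero: `descendingSeries N r` is the step
`N^(r + 1)`, where `N^(1) = N` and `N^(r + 1) = [N, N^(r)]`. -/
def descendingSeries (N : Submodule ℂ L) : ℕ → Submodule ℂ L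
  | 0 => N
  | r + 1 => bracketSpan N (descendingSeries N r)

/-- The `i r`-eigenspace of `ad x` (it is zero when `i r` is not an eigenvalue). -/
noncomputable def gradedPiece (x : L) (r : ℤ) : Submodule ℂ L :=
  Module.End.eigenspace (LieAlgebra.ad ℂ L x) ((r : ℂ) * Complex.I)

/-- The conditions that make `x` (an element of the real form) the canonical element of the
parabolic subalgebra `q`: the eigenvalues of `ad x` lie in `i ℤ`, the sum of the eigenspaces
with `r ≥ 0` is `q`, and the eigenspaces with `r > 0` grade the central descending series of the
nilradical of `q`. -/
structure IsCanonicalElementOf (x : L) (q : LieSubalgebra ℂ L) : Prop where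
  parabolic : IsParabolic q
  integral : ∀ μ : ℂ, Module.End.HasEigenvalue (LieAlgebra.ad ℂ L x) μ →
    ∃ m : ℤ, μ = (m : ℂ) * Complex.I
  subalgebra_eq : q.toSubmodule = ⨆ i : ℤ, ⨆ _ : 0 ≤ i, gradedPiece x i
  series_eq : ∀ r : ℕ, descendingSeries (polar q) r =
    ⨆ i : ℤ, ⨆ _ : (r : ℤ) + 1 ≤ i, gradedPiece x i

/-- An element `ξ` of a real Lie algebra `g` is canonical if it is the canonical element of some
parabolic subalgebra of the complexification `ℂ ⊗ g`. -/
def IsCanonical {g : Type*} [LieRing g] [LieAlgebra ℝ g] (ξ : g) : Prop :=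
  ∃ q : LieSubalgebra ℂ (ℂ ⊗[ℝ] g), IsCanonicalElementOf ((1 : ℂ) ⊗ₜ[ℝ] ξ) q

/-- A real matrix as an endomorphism of `ℂ^n`. -/
noncomputable def complexEnd {n : ℕ} (A : Matrix (Fin n) (Fin n) ℝ) :
    Module.End ℂ (Fin n → ℂ) :=
  Matrix.toLin' (A.map (fun t : ℝ => (t : ℂ)))

/-- The set of complex eigenvalues of a real matrix. -/
def eigenvalueSet {n : ℕ} (A : Matrix (Fin n) (Fin n) ℝ) : Set ℂ :=
  {μ : ℂ | (complexEnd A).HasEigenvalue μ}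

/-- The multiplicity of `μ` as an eigenvalue of a real matrix acting on `ℂ^n`: the dimension of the
`μ`-eigenspace (skew matrices are diagonalisable over `ℂ`). -/
noncomputable def multiplicity {n : ℕ} (A : Matrix (Fin n) (Fin n) ℝ) (μ : ℂ) : ℕ :=
  Module.finrank ℂ ((complexEnd A).eigenspace μ)

end CanonicalElement

/-!
Put `i a` for the eigenvalues of `ξ` on `ℂ^n`; they come in pairs `± i a` because `ξ` is real. The
complexification of `so(n)` is `Λ² ℂ^n`, where `u ∧ v` acts as `u vᵀ - v uᵀ`, so for eigenvectors
`u`, `v` with eigenvalues `i a`, `i b` the element `u ∧ v` is an eigenvector of `ad ξ` with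
eigenvalue `i (a + b)`. Everything is read off from these wedges. The condition on the central
descending series says that `g_{r+1} = [g_1, g_r]` for all `r ≥ 1`
(`gradedPiece_succ_le_bracketSpan`, `descendingSeries_upperPart`).

If `ξ` is canonical and `i a` is an eigenvalue with `a > 0`, then `g_1` cannot annihilate the
eigenspace of `-i a`: otherwise all of `∑_{i ≥ 1} g_i` would, whereas for `n > 2` that sum
contains some `u ∧ v` with `u` of eigenvalue `i a` (`exists_mulVec_ne_zero`). Hence `i (a - 1)` is
again an eigenvalue, and together with the integrality of sums of distinct eigenvalues this forces
an unbroken string of integers or half-integers (`exists_eq_setOf_of_sub_one_mem`). For `a = 1/2`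
there are `y ∈ g_1` and `t` of eigenvalue `-i/2` with `y t ≠ 0`; skewness makes `y t` orthogonal
to `t`, and so independent of the conjugate of `t`, which gives the multiplicity.

Conversely, given such a string, `u ∧ v ∈ g_{r+1}` is, up to a scalar, a bracket of `v ∧ w̄ ∈ g_1`
with `u ∧ w`, where `w` has eigenvalue `i (b - 1)`. Only the weights `3/2` and `1/2` need the
multiplicity hypothesis (`wedge_mem_bracketSpan`). The polar of `q = ∑_{i ≥ 0} g_i` is `∑_{i ≥ 1}
g_i` because the Killing form is `(n - 2) tr (y z)` (`killingForm_eq`) and the conjugate transpose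
exchanges `g_i` and `g_{-i}`. Finally `q` is parabolic: take a maximal element among the solvable
subalgebras of `q` that contain `ξ` and `∑_{i ≥ 1} g_i`. Any solvable subalgebra above it stays
inside `q`, since an element of negative degree and its conjugate transpose would lie in a
solvable subalgebra closed under conjugate transpose and containing `ξ`; such a subalgebra is
abelian (`lie_eq_zero_of_derivedSpan_eq_bot`).
-/

namespace CanonicalElement

/-! ### The grading by the eigenspaces of `ad x` -/

section Grading

variable {L : Type*} [LieRing L] [LieAlgebra ℂ L]

lemma mem_gradedPiece {x y : L} {m : ℤ} :
    y ∈ gradedPiece x m ↔ ⁅x, y⁆ = ((m : ℂ) * Complex.I) • y := by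
  simp [gradedPiece]

lemma lie_mem_gradedPiece {x y z : L} {i j : ℤ} (hy : y ∈ gradedPiece x i)
    (hz : z ∈ gradedPiece x j) : ⁅y, z⁆ ∈ gradedPiece x (i + j) := by
  rw [mem_gradedPiece] at *
  rw [leibniz_lie, hy, hz, smul_lie, lie_smul, ← add_smul]
  push_cast
  ring_nf

lemma self_mem_gradedPiece (x : L) : x ∈ gradedPiece x 0 := by
  simp [mem_gradedPiece]

lemma intCast_mul_I_injective : Function.Injective fun m : ℤ => (m : ℂ) * Complex.I := by
  intro a b h
  simpa using h

lemma gradedPiece_iSupIndep (x : L) : iSupIndep (gradedPiece x) :=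
  (Module.End.eigenspaces_iSupIndep (LieAlgebra.ad ℂ L x)).comp intCast_mul_I_injective

/-- Since the graded pieces are independent, inclusions in `g_m` may be checked modulo the other
pieces. -/
lemma gradedPiece_le_of_le_sup {x : L} {m : ℤ} {B : Submodule ℂ L} (hB : B ≤ gradedPiece x m)
    (h : gradedPiece x m ≤ B ⊔ ⨆ (j) (_ : j ≠ m), gradedPiece x j) : gradedPiece x m ≤ B := by
  intro z hz
  obtain ⟨b, hb, c, hc, rfl⟩ := Submodule.mem_sup.mp (h hz)
  have hc' : c ∈ gradedPiece x m := by
    simpa using Submodule.sub_mem _ hz (hB hb)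
  have := (Submodule.disjoint_def.mp (gradedPiece_iSupIndep x m)) c hc' hc
  simpa [this] using hb

lemma bracketSpan_mono {A A' B B' : Submodule ℂ L} (hA : A ≤ A') (hB : B ≤ B') :
    bracketSpan A B ≤ bracketSpan A' B' := by
  apply Submodule.span_mono
  rintro z ⟨a, ha, b, hb, rfl⟩
  exact ⟨a, hA ha, b, hB hb, rfl⟩

lemma lie_mem_bracketSpan {A B : Submodule ℂ L} {a b : L} (ha : a ∈ A) (hb : b ∈ B) :
    ⁅a, b⁆ ∈ bracketSpan A B :=
  Submodule.subset_span ⟨a, ha, b, hb, rfl⟩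

lemma bracketSpan_le {A B C : Submodule ℂ L} (h : ∀ a ∈ A, ∀ b ∈ B, ⁅a, b⁆ ∈ C) :
    bracketSpan A B ≤ C := by
  apply Submodule.span_le.mpr
  rintro z ⟨a, ha, b, hb, rfl⟩
  exact h a ha b hb

/-- The sum of the graded pieces of degree at least `m`. -/
noncomputable def upperPart (x : L) (m : ℤ) : Submodule ℂ L :=
  ⨆ i : ℤ, ⨆ _ : m ≤ i, gradedPiece x i

lemma gradedPiece_le_upperPart (x : L) {m i : ℤ} (h : m ≤ i) :
    gradedPiece x i ≤ upperPart x m :=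
  le_iSup₂_of_le i h le_rfl

lemma upperPart_le {x : L} {m : ℤ} {p : Submodule ℂ L} (h : ∀ i, m ≤ i → gradedPiece x i ≤ p) :
    upperPart x m ≤ p :=
  iSup₂_le h

lemma upperPart_antitone (x : L) {m m' : ℤ} (h : m ≤ m') : upperPart x m' ≤ upperPart x m :=
  upperPart_le fun _ hi => gradedPiece_le_upperPart x (h.trans hi)

lemma upperPart_induction {x : L} {m : ℤ} {p : L → Prop}
    (h : ∀ i, m ≤ i → ∀ y ∈ gradedPiece x i, p y) (h0 : p 0) (hadd : ∀ y z, p y → p z → p (y + z))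
    {y : L} (hy : y ∈ upperPart x m) : p y := by
  refine Submodule.iSup_induction (fun i : ℤ => ⨆ _ : m ≤ i, gradedPiece x i) (motive := p) hy ?_ h0 hadd
  intro i z hz
  by_cases hi : m ≤ i
  · exact h i hi z (by simpa [hi] using hz)
  · have : z = 0 := by simpa [hi] using hz
    exact this ▸ h0

lemma upperPart_le_sup (x : L) (m : ℤ) :
    upperPart x m ≤ gradedPiece x m ⊔ upperPart x (m + 1) := by
  refine upperPart_le fun i hi => ?_
  rcases hi.eq_or_lt with rfl | hi
  · exact le_sup_left
  · exact le_sup_of_le_right (gradedPiece_le_upperPart x hi)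

lemma lie_mem_upperPart {x y z : L} {a b : ℤ} (hy : y ∈ upperPart x a) (hz : z ∈ upperPart x b) :
    ⁅y, z⁆ ∈ upperPart x (a + b) := by
  refine upperPart_induction (p := fun y => ⁅y, z⁆ ∈ upperPart x (a + b)) ?_ (by simp)
    (fun y y' h h' => by rw [add_lie]; exact add_mem h h') hy
  intro i hi y hy
  refine upperPart_induction (p := fun z => ⁅y, z⁆ ∈ upperPart x (a + b)) ?_ (by simp)
    (fun y y' h h' => by rw [lie_add]; exact add_mem h h') hz
  intro j hj z hz
  exact gradedPiece_le_upperPart x (by lia) (lie_mem_gradedPiece hy hz)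

lemma exists_upperPart_eq_bot [FiniteDimensional ℂ L] (x : L) :
    ∃ N : ℕ, upperPart x N = ⊥ := by
  have hfin : {m : ℤ | gradedPiece x m ≠ ⊥}.Finite :=
    (Module.End.finite_hasEigenvalue (LieAlgebra.ad ℂ L x)).preimage
      intCast_mul_I_injective.injOn
  obtain ⟨M, hM⟩ := hfin.bddAbove
  refine ⟨(M + 1).toNat, eq_bot_iff.mpr (upperPart_le fun i hi => ?_)⟩
  by_contra h
  have := hM (show i ∈ {m : ℤ | gradedPiece x m ≠ ⊥} from fun h' => h h'.le)
  lia

lemma hasEigenvalue_ad_of_iSup_eq_top {x : L} (htop : ⨆ i, gradedPiece x i = ⊤) {μ : ℂ}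
    (hμ : (LieAlgebra.ad ℂ L x).HasEigenvalue μ) : ∃ m : ℤ, μ = (m : ℂ) * Complex.I := by
  by_contra! h
  have hd := Module.End.eigenspaces_iSupIndep (LieAlgebra.ad ℂ L x) μ
  have : (⊤ : Submodule ℂ L) ≤ ⨆ (j) (_ : j ≠ μ), (LieAlgebra.ad ℂ L x).eigenspace j := by
    rw [← htop]
    exact iSup_le fun i => le_iSup₂_of_le ((i : ℂ) * Complex.I) (h i).symm le_rfl
  rw [top_le_iff.mp this, disjoint_top] at hd
  exact hμ hd

/-- A submodule stable under `ad x` is the sum of its intersections with the graded pieces. -/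
lemma le_iSup_inf_gradedPiece [FiniteDimensional ℂ L] {x : L} (htop : ⨆ i, gradedPiece x i = ⊤)
    {p : Submodule ℂ L} (hp : ∀ y ∈ p, ⁅x, y⁆ ∈ p) : p ≤ ⨆ i, p ⊓ gradedPiece x i := by
  have htop' : ⨆ μ, (LieAlgebra.ad ℂ L x).genEigenspace μ 1 = ⊤ := by
    rw [eq_top_iff, ← htop]
    exact iSup_le fun i => le_iSup_of_le ((i : ℂ) * Complex.I) le_rfl
  refine (Submodule.eq_iSup_inf_genEigenspace 1 (f := LieAlgebra.ad ℂ L x) hp htop').le.trans ?_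
  refine iSup_le fun μ => ?_
  by_cases hμ : (LieAlgebra.ad ℂ L x).HasEigenvalue μ
  · obtain ⟨m, rfl⟩ := hasEigenvalue_ad_of_iSup_eq_top htop hμ
    exact le_iSup_of_le m le_rfl
  · have : (LieAlgebra.ad ℂ L x).genEigenspace μ 1 = ⊥ := not_not.mp hμ
    simp [this]

/-- If the central descending series of `N` is graded by `x`, then each graded piece of degree at
least two is generated by `g_1` and the preceding piece. -/
lemma gradedPiece_succ_le_bracketSpan {x : L} {N : Submodule ℂ L}
    (h : ∀ r : ℕ, descendingSeries N r = upperPart x (r + 1)) (r : ℕ) :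
    gradedPiece x (r + 2) ≤ bracketSpan (gradedPiece x 1) (gradedPiece x (r + 1)) := by
  apply gradedPiece_le_of_le_sup
  · refine bracketSpan_le fun a ha b hb => ?_
    convert lie_mem_gradedPiece ha hb using 2
    ring
  have h1 : gradedPiece x (r + 2) ≤ bracketSpan (upperPart x 1) (upperPart x (r + 1)) := by
    have h0 := h 0
    have hr := h (r + 1)
    simp only [descendingSeries, Nat.cast_zero, zero_add] at h0 hr
    rw [h r, h0] at hr
    rw [hr]
    exact gradedPiece_le_upperPart x (by push_cast; lia)
  have h3 : upperPart x (r + 3) ≤ ⨆ (j) (_ : j ≠ (r : ℤ) + 2), gradedPiece x j :=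
    upperPart_le fun i hi => le_iSup₂_of_le i (by lia) le_rfl
  refine (h1.trans (bracketSpan_le ?_)).trans (sup_le_sup_left h3 _)
  intro a ha b hb
  obtain ⟨a₁, ha₁, a₂, ha₂, rfl⟩ := Submodule.mem_sup.mp (upperPart_le_sup x _ ha)
  obtain ⟨b₁, hb₁, b₂, hb₂, rfl⟩ := Submodule.mem_sup.mp (upperPart_le_sup x _ hb)
  rw [lie_add, add_lie, add_assoc]
  refine Submodule.add_mem_sup (lie_mem_bracketSpan ha₁ hb₁) (add_mem ?_ ?_)
  · exact upperPart_antitone x (by lia)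
      (lie_mem_upperPart ha₂ (gradedPiece_le_upperPart x le_rfl hb₁))
  · exact upperPart_antitone x (by lia) (lie_mem_upperPart ha hb₂)

/-- If each graded piece of degree at least two is generated by `g_1` and the preceding piece,
then the central descending series of the positive part is graded by `x`. -/
lemma descendingSeries_upperPart {x : L}
    (h : ∀ r : ℕ, gradedPiece x (r + 2) ≤
      bracketSpan (gradedPiece x 1) (gradedPiece x (r + 1))) (r : ℕ) :
    descendingSeries (upperPart x 1) r = upperPart x (r + 1) := by
  induction r with
  | zero => simp [descendingSeries]
  | succ r ih =>
    rw [descendingSeries, ih]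
    apply le_antisymm
    · refine bracketSpan_le fun a ha b hb => ?_
      exact upperPart_antitone x (by push_cast; lia) (lie_mem_upperPart ha hb)
    · refine upperPart_le fun i hi => ?_
      obtain ⟨k, rfl⟩ : ∃ k : ℕ, i = k + 2 := ⟨(i - 2).toNat, by push_cast at hi; lia⟩
      refine (h k).trans (bracketSpan_mono (gradedPiece_le_upperPart x le_rfl)
        (gradedPiece_le_upperPart x ?_))
      push_cast at hi
      lia

/-- The derived series of a submodule, formed with linear spans of brackets. -/
def derivedSpan (S : Submodule ℂ L) : ℕ → Submodule ℂ L
  | 0 => S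
  | k + 1 => bracketSpan (derivedSpan S k) (derivedSpan S k)

lemma derivedSpan_mono {S T : Submodule ℂ L} (h : S ≤ T) (k : ℕ) :
    derivedSpan S k ≤ derivedSpan T k := by
  induction k with
  | zero => exact h
  | succ k ih => exact bracketSpan_mono ih ih

lemma map_derivedSeries (s : LieSubalgebra ℂ L) (k : ℕ) :
    ((LieAlgebra.derivedSeries ℂ s k).toSubmodule).map s.toSubmodule.subtype =
      derivedSpan s.toSubmodule k := by
  induction k with
  | zero => simp [derivedSpan]
  | succ k ih =>
    rw [derivedSpan, ← ih, LieAlgebra.derivedSeries_def, LieAlgebra.derivedSeriesOfIdeal_succ,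
      LieSubmodule.lieIdeal_oper_eq_linear_span', Submodule.map_span, ← LieAlgebra.derivedSeries_def,
      bracketSpan]
    congr 1
    ext z
    constructor
    · rintro ⟨_, ⟨a, ha, b, hb, rfl⟩, rfl⟩
      exact ⟨a, ⟨a, ha, rfl⟩, b, ⟨b, hb, rfl⟩, rfl⟩
    · rintro ⟨_, ⟨a, ha, rfl⟩, _, ⟨b, hb, rfl⟩, rfl⟩
      exact ⟨_, ⟨a, ha, b, hb, rfl⟩, rfl⟩

lemma isSolvable_iff_derivedSpan (s : LieSubalgebra ℂ L) :
    LieAlgebra.IsSolvable s ↔ ∃ k, derivedSpan s.toSubmodule k = ⊥ := by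
  rw [LieAlgebra.isSolvable_iff ℂ]
  refine exists_congr fun k => ?_
  rw [← map_derivedSeries, ← LieSubmodule.toSubmodule_eq_bot]
  exact ⟨fun h => by rw [h, Submodule.map_bot], fun h =>
    Submodule.map_injective_of_injective s.toSubmodule.injective_subtype
      (h.trans (Submodule.map_bot _).symm)⟩

end Grading

/-! ### The Lie algebra of skew-symmetric matrices -/

section SkewRealization

open Matrix

variable {n : ℕ} {L : Type*} [LieRing L] [LieAlgebra ℂ L]

/-- A faithful representation of a complex Lie algebra on `ℂ^n` whose image is the Lie algebra of
all complex skew-symmetric matrices. -/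
structure IsSkewRealization (ρ : L →ₗ[ℂ] Matrix (Fin n) (Fin n) ℂ) : Prop where
  map_lie : ∀ y z, ρ ⁅y, z⁆ = ρ y * ρ z - ρ z * ρ y
  injective : Function.Injective ρ
  range : ∀ B : Matrix (Fin n) (Fin n) ℂ, (∃ y, ρ y = B) ↔ Bᵀ = -B

lemma trace_end_matrix (f : Module.End ℂ (Matrix (Fin n) (Fin n) ℂ)) :
    LinearMap.trace ℂ _ f = ∑ i, ∑ j, f (single i j 1) i j := by
  rw [LinearMap.trace_eq_matrix_trace ℂ (Matrix.stdBasis ℂ (Fin n) (Fin n)), Matrix.trace,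
    Fintype.sum_prod_type]
  simp [Matrix.diag_apply, LinearMap.toMatrix_apply, Matrix.stdBasis,
    single_eq_of_single_single]

lemma mul_single_mul_apply (P Q : Matrix (Fin n) (Fin n) ℂ) (i j a b : Fin n) :
    (P * single i j (1 : ℂ) * Q) a b = P a i * Q j b := by
  rw [Matrix.mul_assoc, mul_apply, Finset.sum_eq_single i]
  · simp
  · intro c _ hc
    rw [single_mul_apply_of_ne (h := hc), mul_zero]
  · simp

namespace IsSkewRealization

variable {ρ : L →ₗ[ℂ] Matrix (Fin n) (Fin n) ℂ} (hρ : IsSkewRealization ρ)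

include hρ

lemma transpose_map (y : L) : (ρ y)ᵀ = -ρ y :=
  (hρ.range _).mp ⟨y, rfl⟩

lemma exists_wedge (u v : Fin n → ℂ) : ∃ y, ρ y = vecMulVec u v - vecMulVec v u :=
  (hρ.range _).mpr (by simp [transpose_vecMulVec])

/-- The element `u ∧ v` of `Λ² ℂ^n`, as the element of the Lie algebra that acts as the skew matrix
`u vᵀ - v uᵀ`. -/
noncomputable def wedge (u v : Fin n → ℂ) : L := (hρ.exists_wedge u v).choose

lemma map_wedge (u v : Fin n → ℂ) : ρ (hρ.wedge u v) = vecMulVec u v - vecMulVec v u :=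
  (hρ.exists_wedge u v).choose_spec

lemma wedge_mulVec (u v t : Fin n → ℂ) :
    ρ (hρ.wedge u v) *ᵥ t = (v ⬝ᵥ t) • u - (u ⬝ᵥ t) • v := by
  simp [map_wedge, sub_mulVec, vecMulVec_mulVec]

lemma wedge_add_left (u u' v : Fin n → ℂ) :
    hρ.wedge (u + u') v = hρ.wedge u v + hρ.wedge u' v := by
  apply hρ.injective
  simp only [map_add, map_wedge, add_vecMulVec, vecMulVec_add]
  abel

lemma wedge_swap (u v : Fin n → ℂ) : hρ.wedge v u = -hρ.wedge u v := by
  apply hρ.injective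
  simp [map_wedge]

lemma wedge_add_right (u v v' : Fin n → ℂ) :
    hρ.wedge u (v + v') = hρ.wedge u v + hρ.wedge u v' := by
  rw [hρ.wedge_swap _ u, wedge_add_left, neg_add, ← wedge_swap, ← wedge_swap]

lemma wedge_smul_left (c : ℂ) (u v : Fin n → ℂ) :
    hρ.wedge (c • u) v = c • hρ.wedge u v := by
  apply hρ.injective
  simp [map_wedge, smul_vecMulVec, vecMulVec_smul, smul_sub]

lemma wedge_smul_right (c : ℂ) (u v : Fin n → ℂ) :
    hρ.wedge u (c • v) = c • hρ.wedge u v := by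
  rw [hρ.wedge_swap _ u, wedge_smul_left, ← smul_neg, ← wedge_swap]

@[simp] lemma wedge_zero_left (v : Fin n → ℂ) : hρ.wedge 0 v = 0 := by
  simpa using hρ.wedge_smul_left 0 0 v

@[simp] lemma wedge_zero_right (v : Fin n → ℂ) : hρ.wedge v 0 = 0 := by
  simpa using hρ.wedge_smul_right 0 v 0

lemma lie_wedge (y : L) (u v : Fin n → ℂ) :
    ⁅y, hρ.wedge u v⁆ = hρ.wedge (ρ y *ᵥ u) v + hρ.wedge u (ρ y *ᵥ v) := by
  have h : ∀ t : Fin n → ℂ, t ᵥ* ρ y = -(ρ y *ᵥ t) := fun t => by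
    rw [← mulVec_transpose, hρ.transpose_map, neg_mulVec]
  apply hρ.injective
  rw [hρ.map_lie, map_add, map_wedge, map_wedge, map_wedge, mul_sub, sub_mul,
    mul_vecMulVec, mul_vecMulVec, vecMulVec_mul, vecMulVec_mul, h, h, vecMulVec_neg, vecMulVec_neg]
  abel

lemma eq_sum_wedge (y : L) :
    y = ∑ j, (1 / 2 : ℂ) • hρ.wedge ((ρ y).col j) (Pi.single j 1) := by
  have h : ∑ j, vecMulVec ((ρ y).col j) (Pi.single j 1) = ρ y := by
    ext a b
    simp [Matrix.sum_apply, vecMulVec_apply, Pi.single_apply]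
  apply hρ.injective
  rw [map_sum]
  simp only [map_smul, map_wedge]
  rw [← Finset.smul_sum, Finset.sum_sub_distrib]
  have h' : ∑ j, vecMulVec (Pi.single j 1) ((ρ y).col j) = -ρ y := by
    rw [← hρ.transpose_map, ← h, transpose_sum, h]
    simp [transpose_vecMulVec]
  rw [h, h', sub_neg_eq_add, ← two_smul ℂ, smul_smul]
  norm_num

lemma exists_adj (y : L) : ∃ z, ρ z = (ρ y)ᴴ := by
  refine (hρ.range _).mpr ?_
  have h := congrArg conjTranspose (hρ.transpose_map y)
  rwa [conjTranspose_neg] at h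

/-- The conjugate transpose on the Lie algebra of complex skew-symmetric matrices. -/
noncomputable def adj (y : L) : L := (hρ.exists_adj y).choose

lemma map_adj (y : L) : ρ (hρ.adj y) = (ρ y)ᴴ := (hρ.exists_adj y).choose_spec

lemma adj_adj (y : L) : hρ.adj (hρ.adj y) = y := by
  apply hρ.injective
  simp [map_adj]

lemma adj_add (y z : L) : hρ.adj (y + z) = hρ.adj y + hρ.adj z := by
  apply hρ.injective
  simp [map_adj]

lemma adj_smul (c : ℂ) (y : L) : hρ.adj (c • y) = star c • hρ.adj y := by
  apply hρ.injective
  simp [map_adj]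

lemma adj_lie (y z : L) : hρ.adj ⁅y, z⁆ = ⁅hρ.adj z, hρ.adj y⁆ := by
  apply hρ.injective
  simp [map_adj, hρ.map_lie]

lemma eq_zero_of_trace_mul_adj (y : L) (h : (ρ y * ρ (hρ.adj y)).trace = 0) : y = 0 := by
  apply hρ.injective
  open scoped ComplexOrder in
  rw [map_adj, trace_mul_conjTranspose_self_eq_zero_iff] at h
  simpa using h

/-- The projection of all matrices onto the Lie algebra of skew-symmetric ones. -/
noncomputable def skewPart : Matrix (Fin n) (Fin n) ℂ →ₗ[ℂ] L :=
  (LinearEquiv.ofInjective ρ hρ.injective).symm.toLinearMap ∘ₗ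
    (LinearMap.codRestrict _
      ((1 / 2 : ℂ) • (LinearMap.id - (transposeLinearEquiv (Fin n) (Fin n) ℂ ℂ).toLinearMap))
      fun B => (hρ.range _).mpr (by
        simp [transpose_sub, ← smul_neg]))

lemma map_skewPart (B : Matrix (Fin n) (Fin n) ℂ) :
    ρ (hρ.skewPart B) = (1 / 2 : ℂ) • (B - Bᵀ) := by
  have := LinearEquiv.ofInjective_symm_apply (f := ρ)
    (h := hρ.injective)
  simp only [skewPart, LinearMap.comp_apply]
  exact (this _).trans (by simp)

lemma skewPart_map (y : L) : hρ.skewPart (ρ y) = y := by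
  apply hρ.injective
  rw [map_skewPart, hρ.transpose_map, sub_neg_eq_add, ← two_smul ℂ, smul_smul]
  norm_num

/-- The Killing form of the Lie algebra of skew-symmetric matrices is `n - 2` times the trace form
of the defining representation. The trace over the Lie algebra is computed as a trace over all
matrices, by means of the projection onto skew-symmetric matrices. -/
lemma killingForm_eq [FiniteDimensional ℂ L] (y z : L) :
    killingForm ℂ L y z = ((n : ℂ) - 2) * (ρ y * ρ z).trace := by
  set φ : Module.End ℂ L := LieAlgebra.ad ℂ L y ∘ₗ LieAlgebra.ad ℂ L z with hφ
  have h1 : killingForm ℂ L y z = LinearMap.trace ℂ _ (ρ ∘ₗ (φ ∘ₗ hρ.skewPart)) := by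
    rw [LinearMap.trace_comp_comm', killingForm_apply_apply]
    congr 1
    ext w
    simp [hφ, skewPart_map]
  have h2 : ∀ B, (ρ ∘ₗ (φ ∘ₗ hρ.skewPart)) B =
      (1 / 2 : ℂ) • (ρ y * (ρ z * (B - Bᵀ) - (B - Bᵀ) * ρ z) -
        (ρ z * (B - Bᵀ) - (B - Bᵀ) * ρ z) * ρ y) := fun B => by
    simp [hφ, hρ.map_lie, map_skewPart]
    simp only [← smul_sub, mul_smul_comm, smul_mul_assoc]
  have hzy : ∀ i j, ρ z i j = -ρ z j i := fun i j => by
    simpa using congrFun (congrFun (hρ.transpose_map z) j) i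
  -- Diagonal entries of skew matrices vanish, so the products of traces below drop out.
  have hd : ∀ w i, ρ w i i = 0 := fun w i => by
    have := congrFun (congrFun (hρ.transpose_map w) i) i
    exact self_eq_neg.mp this
  -- The `(i, j)` entry of the image of the matrix unit at `(i, j)`, by bilinear expansion.
  have h3 : ∀ i j : Fin n, (ρ ∘ₗ (φ ∘ₗ hρ.skewPart)) (single i j 1) i j = (1 / 2 : ℂ) *
      ((ρ y * ρ z) i i - (ρ y * ρ z) i j * (1 : Matrix (Fin n) (Fin n) ℂ) i j
        - (ρ y i i * ρ z j j - ρ y i j * ρ z i j)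
        - (ρ z i i * ρ y j j - ρ z i j * ρ y i j)
        + ((ρ z * ρ y) j j - (1 : Matrix (Fin n) (Fin n) ℂ) i j * (ρ z * ρ y) i j)) := fun i j => by
    have e1 : ρ y * (ρ z * (single i j 1 - (single i j 1)ᵀ) - (single i j 1 - (single i j 1)ᵀ) * ρ z)
        - (ρ z * (single i j 1 - (single i j 1)ᵀ) - (single i j 1 - (single i j 1)ᵀ) * ρ z) * ρ y =
        ((ρ y * ρ z) * single i j 1 * 1 - (ρ y * ρ z) * single j i 1 * 1)
        - (ρ y * single i j 1 * ρ z - ρ y * single j i 1 * ρ z)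
        - (ρ z * single i j 1 * ρ y - ρ z * single j i 1 * ρ y)
        + (1 * single i j 1 * (ρ z * ρ y) - 1 * single j i 1 * (ρ z * ρ y)) := by
      rw [transpose_single]
      noncomm_ring
    rw [h2, e1]
    simp only [Matrix.smul_apply, Matrix.sub_apply, Matrix.add_apply, mul_single_mul_apply,
      smul_eq_mul]
    simp only [one_apply_eq, mul_one, one_mul]
  rw [h1, trace_end_matrix]
  have h4 : ∑ i, ∑ j, ρ y i j * ρ z i j = -(ρ y * ρ z).trace := by
    simp only [Matrix.trace, diag_apply, mul_apply, ← Finset.sum_neg_distrib]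
    exact Finset.sum_congr rfl fun i _ => Finset.sum_congr rfl fun j _ => by rw [hzy i j]; ring
  have h5 : (ρ z * ρ y).trace = (ρ y * ρ z).trace := trace_mul_comm _ _
  have h6 : ∀ w : Matrix (Fin n) (Fin n) ℂ, ∑ i, w i i = w.trace := fun _ => rfl
  simp only [h3, hd, ← Finset.mul_sum, Finset.sum_add_distrib, Finset.sum_sub_distrib, one_apply,
    mul_ite, ite_mul, mul_one, one_mul, mul_zero, zero_mul, Finset.sum_ite_eq, Finset.mem_univ,
    if_true, Finset.sum_const, Finset.card_univ, Fintype.card_fin, h6, h5, h4,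
    mul_comm (ρ z _ _) (ρ y _ _), nsmul_eq_mul]
  ring

end IsSkewRealization
end SkewRealization

/-! ### Eigenvectors of a real skew-symmetric matrix -/

section Eigenspaces

open Matrix

variable {n : ℕ} {A : Matrix (Fin n) (Fin n) ℝ}

/-- The eigenspace of a real matrix on `ℂ^n` for the purely imaginary eigenvalue `i a`. -/
noncomputable def imagEigenspace (A : Matrix (Fin n) (Fin n) ℝ) (a : ℝ) :
    Submodule ℂ (Fin n → ℂ) :=
  (complexEnd A).eigenspace ((a : ℂ) * Complex.I)

lemma mem_imagEigenspace {a : ℝ} {v : Fin n → ℂ} :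
    v ∈ imagEigenspace A a ↔
      A.map (fun t : ℝ => (t : ℂ)) *ᵥ v = ((a : ℂ) * Complex.I) • v := by
  simp [imagEigenspace, complexEnd]

lemma star_mulVec_map_ofReal (v : Fin n → ℂ) :
    star (A.map (fun t : ℝ => (t : ℂ)) *ᵥ v) = A.map (fun t : ℝ => (t : ℂ)) *ᵥ star v := by
  ext i
  simp [mulVec, dotProduct]

lemma star_mem_imagEigenspace {a : ℝ} {v : Fin n → ℂ} (h : v ∈ imagEigenspace A a) :
    star v ∈ imagEigenspace A (-a) := by
  rw [mem_imagEigenspace] at *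
  rw [← star_mulVec_map_ofReal, h, star_smul]
  simp

lemma imagEigenspace_neg_ne_bot {a : ℝ} (h : imagEigenspace A a ≠ ⊥) :
    imagEigenspace A (-a) ≠ ⊥ := by
  obtain ⟨v, hv, hv0⟩ := Submodule.exists_mem_ne_zero_of_ne_bot h
  exact (Submodule.ne_bot_iff _).mpr ⟨_, star_mem_imagEigenspace hv, star_ne_zero.mpr hv0⟩

lemma dotProduct_star_ne_zero {v : Fin n → ℂ} (hv : v ≠ 0) : v ⬝ᵥ star v ≠ 0 := by
  open scoped ComplexOrder in
  rw [dotProduct_comm]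
  exact fun h => hv (dotProduct_star_self_eq_zero.mp h)

lemma imagEigenspace_disjoint {a b : ℝ} (hab : a ≠ b) {v : Fin n → ℂ}
    (ha : v ∈ imagEigenspace A a) (hb : v ∈ imagEigenspace A b) : v = 0 := by
  rw [mem_imagEigenspace] at ha hb
  have h : (((a : ℂ) - b) * Complex.I) • v = 0 := by
    rw [sub_mul, sub_smul, ← ha, ← hb, sub_self]
  refine (smul_eq_zero.mp h).resolve_left (mul_ne_zero ?_ Complex.I_ne_zero)
  exact_mod_cast sub_ne_zero.mpr hab

variable (hA : Aᵀ = -A)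
include hA

lemma transpose_map_ofReal :
    (A.map (fun t : ℝ => (t : ℂ)))ᵀ = -A.map (fun t : ℝ => (t : ℂ)) := by
  rw [← transpose_map, hA]
  ext
  simp

lemma dotProduct_mulVec_skew (u v : Fin n → ℂ) :
    u ⬝ᵥ (A.map (fun t : ℝ => (t : ℂ)) *ᵥ v) = -((A.map (fun t : ℝ => (t : ℂ)) *ᵥ u) ⬝ᵥ v) := by
  rw [dotProduct_mulVec, ← mulVec_transpose, transpose_map_ofReal hA, neg_mulVec, neg_dotProduct]

/-- The standard bilinear form pairs the `i a`- and `i b`-eigenspaces trivially, unless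
`a + b = 0`. -/
lemma dotProduct_eq_zero_of_mem_imagEigenspace {a b : ℝ} (hab : a + b ≠ 0) {u v : Fin n → ℂ}
    (hu : u ∈ imagEigenspace A a) (hv : v ∈ imagEigenspace A b) : u ⬝ᵥ v = 0 := by
  rw [mem_imagEigenspace] at hu hv
  have h := dotProduct_mulVec_skew hA u v
  rw [hu, hv, dotProduct_smul, smul_dotProduct, smul_eq_mul, smul_eq_mul] at h
  have h' : ((a + b : ℝ) : ℂ) * Complex.I * (u ⬝ᵥ v) = 0 := by
    push_cast
    linear_combination h
  refine (mul_eq_zero.mp h').resolve_left (mul_ne_zero ?_ Complex.I_ne_zero)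
  exact_mod_cast hab

/-- The eigenvalues of a real skew-symmetric matrix are purely imaginary. -/
lemma mem_eigenvalueSet_iff {μ : ℂ} :
    μ ∈ eigenvalueSet A ↔ ∃ a : ℝ, μ = (a : ℂ) * Complex.I ∧ imagEigenspace A a ≠ ⊥ := by
  constructor
  · intro h
    obtain ⟨v, hv⟩ := Module.End.HasEigenvalue.exists_hasEigenvector h
    have hv1 : A.map (fun t : ℝ => (t : ℂ)) *ᵥ v = μ • v := by
      simpa [complexEnd] using hv.apply_eq_smul
    have h1 := dotProduct_mulVec_skew hA v (star v)
    rw [← star_mulVec_map_ofReal, hv1, star_smul, dotProduct_smul, smul_dotProduct, smul_eq_mul,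
      smul_eq_mul, ← neg_mul] at h1
    have h2 := mul_right_cancel₀ (dotProduct_star_ne_zero hv.2) h1
    have h3 : μ = ((μ.im : ℝ) : ℂ) * Complex.I := by
      have := congrArg Complex.re h2
      simp at this
      apply Complex.ext
      · simp
        linarith
      · simp
    refine ⟨μ.im, h3, ?_⟩
    rw [imagEigenspace, ← h3]
    exact h
  · rintro ⟨a, rfl, h⟩
    exact h

/-- A real skew-symmetric matrix is diagonalisable over `ℂ`. -/
lemma iSup_imagEigenspace_eq_top : ⨆ a, imagEigenspace A a = ⊤ := by
  set C := A.map (fun t : ℝ => (t : ℂ)) with hC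
  have hH : ((-Complex.I) • C).IsHermitian := by
    have : Cᴴ = -C := by
      rw [← transpose_map_ofReal hA]
      ext
      simp [hC]
    rw [Matrix.IsHermitian, conjTranspose_smul, this]
    simp
  have hmem : ∀ j, ⇑(hH.eigenvectorBasis j) ∈ imagEigenspace A (hH.eigenvalues j) := fun j => by
    rw [mem_imagEigenspace]
    have h := congrArg (Complex.I • ·) (hH.mulVec_eigenvectorBasis j)
    simp only [smul_mulVec, smul_smul] at h
    rw [← hC, mul_comm, mul_smul, Complex.coe_smul]
    simpa using h
  rw [eq_top_iff]
  rintro v -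
  have h := congrArg (WithLp.linearEquiv 2 ℂ (Fin n → ℂ))
    (hH.eigenvectorBasis.sum_repr' (WithLp.toLp 2 v))
  simp only [map_sum, map_smul] at h
  have h' : ∑ j, inner ℂ (hH.eigenvectorBasis j) (WithLp.toLp 2 v) •
      ⇑(hH.eigenvectorBasis j) = v := h
  rw [← h']
  exact sum_mem fun j _ => Submodule.smul_mem _ _ (Submodule.mem_iSup_of_mem _ (hmem j))

end Eigenspaces

section Weights

open Matrix

variable {n : ℕ} {A : Matrix (Fin n) (Fin n) ℝ} {L : Type*} [LieRing L] [LieAlgebra ℂ L]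
  {ρ : L →ₗ[ℂ] Matrix (Fin n) (Fin n) ℂ} (hρ : IsSkewRealization ρ) {x : L}
  (hx : ρ x = A.map (fun t : ℝ => (t : ℂ)))

include hρ hx

lemma transpose_eq_neg_of_map_eq : Aᵀ = -A := by
  have h := hρ.transpose_map x
  rw [hx] at h
  ext i j
  have := congrFun (congrFun h i) j
  simp only [transpose_apply, map_apply, Matrix.neg_apply] at this ⊢
  exact_mod_cast this

lemma lie_wedge_eq_smul {a b : ℝ} {u v : Fin n → ℂ} (hu : u ∈ imagEigenspace A a)
    (hv : v ∈ imagEigenspace A b) :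
    ⁅x, hρ.wedge u v⁆ = (((a + b : ℝ) : ℂ) * Complex.I) • hρ.wedge u v := by
  rw [mem_imagEigenspace] at hu hv
  rw [hρ.lie_wedge, hx, hu, hv, hρ.wedge_smul_left, hρ.wedge_smul_right, ← add_smul]
  push_cast
  ring_nf

lemma wedge_mem_gradedPiece {a b : ℝ} {m : ℤ} {u v : Fin n → ℂ} (hu : u ∈ imagEigenspace A a)
    (hv : v ∈ imagEigenspace A b) (hm : a + b = m) : hρ.wedge u v ∈ gradedPiece x m := by
  rw [mem_gradedPiece, lie_wedge_eq_smul hρ hx hu hv, hm, Complex.ofReal_intCast]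

lemma mulVec_mem_imagEigenspace {a : ℝ} {m : ℤ} {y : L} {t : Fin n → ℂ}
    (hy : y ∈ gradedPiece x m) (ht : t ∈ imagEigenspace A a) :
    ρ y *ᵥ t ∈ imagEigenspace A (a + m) := by
  rw [mem_gradedPiece] at hy
  rw [mem_imagEigenspace] at *
  have h := congrArg (fun z => ρ z *ᵥ t) hy
  simp only [hρ.map_lie, map_smul, sub_mulVec, ← mulVec_mulVec, smul_mulVec, hx, ht,
    mulVec_smul] at h
  rw [sub_eq_iff_eq_add.mp h, ← add_smul]
  push_cast
  ring_nf

lemma adj_eq_neg : hρ.adj x = -x := by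
  apply hρ.injective
  rw [hρ.map_adj, map_neg, ← hρ.transpose_map, hx]
  ext
  simp

lemma adj_mem_gradedPiece {m : ℤ} {y : L} (hy : y ∈ gradedPiece x m) :
    hρ.adj y ∈ gradedPiece x (-m) := by
  rw [mem_gradedPiece] at *
  have h := congrArg hρ.adj hy
  rw [hρ.adj_lie, adj_eq_neg hρ hx, hρ.adj_smul, lie_neg, lie_skew] at h
  rw [h]
  simp

/-- The wedges of eigenvectors span the Lie algebra. -/
lemma eq_top_of_wedge_mem {F : Submodule ℂ L}
    (h : ∀ a b : ℝ, ∀ u ∈ imagEigenspace A a, ∀ v ∈ imagEigenspace A b, hρ.wedge u v ∈ F) :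
    F = ⊤ := by
  have htop := iSup_imagEigenspace_eq_top (transpose_eq_neg_of_map_eq hρ hx)
  have hall : ∀ u v, hρ.wedge u v ∈ F := fun u v => by
    refine Submodule.iSup_induction (imagEigenspace A) (motive := fun u => hρ.wedge u v ∈ F)
      (htop ▸ Submodule.mem_top : u ∈ _) ?_ (by simp)
      (fun u u' h h' => by rw [hρ.wedge_add_left]; exact add_mem h h')
    intro a u hu
    refine Submodule.iSup_induction (imagEigenspace A) (motive := fun v => hρ.wedge u v ∈ F)
      (htop ▸ Submodule.mem_top : v ∈ _) ?_ (by simp)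
      (fun u u' h h' => by rw [hρ.wedge_add_right]; exact add_mem h h')
    exact fun b v hv => h a b u hu v hv
  rw [eq_top_iff]
  rintro y -
  rw [hρ.eq_sum_wedge y]
  exact sum_mem fun j _ => Submodule.smul_mem _ _ (hall _ _)

end Weights

/-! ### Parabolic subalgebras and their polars -/

section Parabolic

open Matrix

variable {n : ℕ} {A : Matrix (Fin n) (Fin n) ℝ} {L : Type*} [LieRing L] [LieAlgebra ℂ L]
  {ρ : L →ₗ[ℂ] Matrix (Fin n) (Fin n) ℂ} (hρ : IsSkewRealization ρ)

lemma derivedSpan_succ_le {S : Submodule ℂ L} (hS : bracketSpan S S ≤ S) (k : ℕ) :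
    derivedSpan S (k + 1) ≤ derivedSpan S k := by
  induction k with
  | zero => exact hS
  | succ k ih => exact bracketSpan_mono ih ih

include hρ

lemma trace_map_lie_mul (a b c : L) :
    (ρ ⁅a, b⁆ * ρ c).trace = (ρ a * ρ ⁅b, c⁆).trace := by
  rw [hρ.map_lie, hρ.map_lie, sub_mul, mul_sub, trace_sub, trace_sub, Matrix.mul_assoc,
    Matrix.mul_assoc (ρ b), trace_mul_comm (ρ b), Matrix.mul_assoc]

lemma adj_mem_derivedSpan {S : Submodule ℂ L} (hS : ∀ y ∈ S, hρ.adj y ∈ S) (k : ℕ) :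
    ∀ y ∈ derivedSpan S k, hρ.adj y ∈ derivedSpan S k := by
  induction k with
  | zero => exact hS
  | succ k ih =>
    intro y hy
    induction hy using Submodule.span_induction with
    | mem y hy =>
      obtain ⟨a, ha, b, hb, rfl⟩ := hy
      rw [hρ.adj_lie]
      exact lie_mem_bracketSpan (ih b hb) (ih a ha)
    | zero =>
      have : hρ.adj 0 = 0 := by simpa using hρ.adj_smul 0 0
      rw [this]
      exact zero_mem _
    | add y z _ _ hy hz =>
      rw [hρ.adj_add]
      exact add_mem hy hz
    | smul c y _ hy =>
      rw [hρ.adj_smul]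
      exact Submodule.smul_mem _ _ hy

/-- A solvable Lie algebra of matrices that is closed under the conjugate transpose is abelian.
The trace form `tr (y z*)` is positive definite; it shows first that an abelian ideal in the derived
series is central in the preceding term, and then that it vanishes. -/
lemma lie_eq_zero_of_derivedSpan_eq_bot {S : Submodule ℂ L} (hS : bracketSpan S S ≤ S)
    (hadj : ∀ y ∈ S, hρ.adj y ∈ S) {k : ℕ} (hk : derivedSpan S k = ⊥) {a b : L} (ha : a ∈ S)
    (hb : b ∈ S) : ⁅a, b⁆ = 0 := by
  have step : ∀ k, derivedSpan S (k + 2) = ⊥ → derivedSpan S (k + 1) = ⊥ := by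
    intro k hk
    have hab : ∀ z ∈ derivedSpan S (k + 1), ∀ w ∈ derivedSpan S (k + 1), ⁅z, w⁆ = 0 :=
      fun z hz w hw => (Submodule.mem_bot ℂ).mp (hk ▸ lie_mem_bracketSpan hz hw)
    have hcentral : ∀ a ∈ derivedSpan S k, ∀ z ∈ derivedSpan S (k + 1), ⁅a, z⁆ = 0 := by
      intro a ha z hz
      have hw : ⁅a, z⁆ ∈ derivedSpan S (k + 1) :=
        lie_mem_bracketSpan ha (derivedSpan_succ_le hS k hz)
      apply hρ.eq_zero_of_trace_mul_adj
      rw [trace_map_lie_mul hρ, hab _ hz _ (adj_mem_derivedSpan hρ hadj _ _ hw)]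
      simp
    rw [eq_bot_iff]
    intro z hz
    apply hρ.eq_zero_of_trace_mul_adj
    have hc := adj_mem_derivedSpan hρ hadj _ _ hz
    generalize hρ.adj z = c at hc
    induction hz using Submodule.span_induction with
    | mem y hy =>
      obtain ⟨a, ha, b, hb, rfl⟩ := hy
      rw [trace_map_lie_mul hρ, hcentral b hb c hc]
      simp
    | zero => simp
    | add y z _ _ hy hz => rw [map_add, add_mul, trace_add, hy, hz, add_zero]
    | smul r y _ hy => rw [map_smul, smul_mul, trace_smul, hy, smul_zero]
  have h1 : derivedSpan S 1 = ⊥ := by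
    have hk' : derivedSpan S (k + 1) = ⊥ :=
      eq_bot_iff.mpr (hk ▸ derivedSpan_succ_le hS k)
    clear hk
    induction k with
    | zero => exact hk'
    | succ k ih => exact ih (step k hk')
  exact (Submodule.mem_bot ℂ).mp (h1 ▸ lie_mem_bracketSpan ha hb)

variable {x : L} (hx : ρ x = A.map (fun t : ℝ => (t : ℂ)))
include hx

/-- A solvable subalgebra that contains `x` and all elements of positive degree has no elements of
negative degree: such an element and its conjugate transpose would lie in a self-adjoint solvable
subalgebra that contains `x`, so would commute with `x`. -/
lemma le_upperPart_zero_of_isSolvable [FiniteDimensional ℂ L]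
    (htop : ⨆ i, gradedPiece x i = ⊤) {s : LieSubalgebra ℂ L} (hs : LieAlgebra.IsSolvable s)
    (hxs : x ∈ s) (hpos : upperPart x 1 ≤ s.toSubmodule) : s.toSubmodule ≤ upperPart x 0 := by
  refine (le_iSup_inf_gradedPiece (p := s.toSubmodule) htop fun y hy => s.lie_mem hxs hy).trans
    (iSup_le fun i => ?_)
  rintro y ⟨hys, hyi⟩
  rcases le_or_gt 0 i with hi | hi
  · exact gradedPiece_le_upperPart x hi hyi
  let S : Submodule ℂ L :=
    { carrier := {y | y ∈ s ∧ hρ.adj y ∈ s}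
      add_mem' := fun h h' => ⟨add_mem h.1 h'.1, by
        rw [hρ.adj_add]; exact add_mem h.2 h'.2⟩
      zero_mem' := ⟨zero_mem s, by
        have : hρ.adj 0 = 0 := by simpa using hρ.adj_smul 0 0
        rw [this]; exact zero_mem s⟩
      smul_mem' := fun c y h => ⟨s.smul_mem c h.1, by
        rw [hρ.adj_smul]; exact s.smul_mem _ h.2⟩ }
  have hSs : S ≤ s.toSubmodule := fun y hy => hy.1
  have hSl : bracketSpan S S ≤ S := bracketSpan_le fun a ha b hb =>
    ⟨s.lie_mem ha.1 hb.1, by rw [hρ.adj_lie]; exact s.lie_mem hb.2 ha.2⟩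
  have hSadj : ∀ y ∈ S, hρ.adj y ∈ S := fun y hy => ⟨hy.2, by rw [hρ.adj_adj]; exact hy.1⟩
  obtain ⟨k, hk⟩ := (isSolvable_iff_derivedSpan s).mp hs
  have hk' : derivedSpan S k = ⊥ := eq_bot_iff.mpr (hk ▸ derivedSpan_mono hSs k)
  have hxS : x ∈ S := ⟨hxs, by rw [adj_eq_neg hρ hx]; exact neg_mem hxs⟩
  have hyS : y ∈ S := ⟨hys, hpos (gradedPiece_le_upperPart x (by lia)
    (adj_mem_gradedPiece hρ hx hyi))⟩
  have h0 := lie_eq_zero_of_derivedSpan_eq_bot hρ hSl hSadj hk' hxS hyS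
  rw [mem_gradedPiece.mp hyi, smul_eq_zero] at h0
  have : y = 0 := h0.resolve_left (mul_ne_zero (by exact_mod_cast hi.ne) Complex.I_ne_zero)
  exact this ▸ zero_mem _

omit hρ hx in
lemma lie_mem_of_mem_span_sup {y z : L} (hy' : y ∈ (ℂ ∙ x) ⊔ upperPart x 1)
    (hz' : z ∈ (ℂ ∙ x) ⊔ upperPart x 1) : ⁅y, z⁆ ∈ upperPart x 1 := by
  obtain ⟨_, hc, y, hy, rfl⟩ := Submodule.mem_sup.mp hy'
  obtain ⟨c, rfl⟩ := Submodule.mem_span_singleton.mp hc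
  obtain ⟨_, hd, z, hz, rfl⟩ := Submodule.mem_sup.mp hz'
  obtain ⟨d, rfl⟩ := Submodule.mem_span_singleton.mp hd
  have hx0 : x ∈ upperPart x 0 := gradedPiece_le_upperPart x le_rfl (self_mem_gradedPiece x)
  have h1 : ⁅x, z⁆ ∈ upperPart x 1 := by simpa using lie_mem_upperPart hx0 hz
  have h2 : ⁅y, x⁆ ∈ upperPart x 1 := by simpa using lie_mem_upperPart hy hx0
  have h3 : ⁅y, z⁆ ∈ upperPart x 1 :=
    upperPart_antitone x (by norm_num : (1 : ℤ) ≤ 1 + 1) (lie_mem_upperPart hy hz)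
  simp only [add_lie, lie_add, smul_lie, lie_smul, lie_self, smul_zero, zero_add]
  exact add_mem (Submodule.smul_mem _ _ h2) (add_mem (Submodule.smul_mem _ _ h1) h3)

omit hρ hx in
/-- The sum of the line through `x` and the elements of positive degree is a solvable subalgebra. -/
lemma exists_isSolvable_span_sup [FiniteDimensional ℂ L] (x : L) :
    ∃ s : LieSubalgebra ℂ L, s.toSubmodule = (ℂ ∙ x) ⊔ upperPart x 1 ∧
      LieAlgebra.IsSolvable s := by
  let s : LieSubalgebra ℂ L :=
    { (ℂ ∙ x) ⊔ upperPart x 1 with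
      lie_mem' := fun hy hz => Submodule.mem_sup_right (lie_mem_of_mem_span_sup hy hz) }
  refine ⟨s, rfl, (isSolvable_iff_derivedSpan s).mpr ?_⟩
  have h : ∀ k : ℕ, derivedSpan s.toSubmodule (k + 1) ≤ upperPart x (k + 1) := by
    intro k
    induction k with
    | zero =>
      rw [Nat.cast_zero, zero_add]
      exact bracketSpan_le fun a ha b hb => lie_mem_of_mem_span_sup ha hb
    | succ k ih =>
      exact bracketSpan_le fun a ha b hb =>
        upperPart_antitone x (by push_cast; lia) (lie_mem_upperPart (ih ha) (ih hb))
  obtain ⟨N, hN⟩ := exists_upperPart_eq_bot x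
  exact ⟨N + 1, eq_bot_iff.mpr ((h N).trans (hN ▸ upperPart_antitone x (by lia)))⟩

lemma isParabolic_of_eq_upperPart [FiniteDimensional ℂ L]
    (htop : ⨆ i, gradedPiece x i = ⊤) {q : LieSubalgebra ℂ L}
    (hq : q.toSubmodule = upperPart x 0) : IsParabolic q := by
  obtain ⟨s₀, hs₀, hsol⟩ := exists_isSolvable_span_sup x
  have hs₀q : s₀ ≤ q := by
    rw [← LieSubalgebra.toSubmodule_le_toSubmodule, hs₀, hq]
    refine sup_le ?_ (upperPart_antitone x (by norm_num))
    rw [Submodule.span_singleton_le_iff_mem]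
    exact gradedPiece_le_upperPart x le_rfl (self_mem_gradedPiece x)
  obtain ⟨b, hb₀, hb⟩ := exists_maximal_ge_of_wellFoundedGT
    (fun s : LieSubalgebra ℂ L => LieAlgebra.IsSolvable s ∧ s ≤ q) s₀ ⟨hsol, hs₀q⟩
  refine ⟨b, ⟨hb.prop.1, fun s hs hbs => hb.le_of_ge ⟨hs, ?_⟩ hbs⟩, hb.prop.2⟩
  have h₀ : (ℂ ∙ x) ⊔ upperPart x 1 ≤ s.toSubmodule := by
    rw [← hs₀]
    exact hb₀.trans hbs
  rw [← LieSubalgebra.toSubmodule_le_toSubmodule, hq]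
  exact le_upperPart_zero_of_isSolvable hρ hx htop hs
    (h₀ (Submodule.mem_sup_left (Submodule.mem_span_singleton_self x))) (le_sup_right.trans h₀)

/-- The polar of the non-negative part for the Killing form is the positive part. The Killing form
is a multiple of the trace form, for which `g_i` is orthogonal to `g_j` unless `i + j = 0`, and
`y ∈ g_i` is not orthogonal to `y* ∈ g_{-i}`. -/
lemma polar_eq_upperPart_one [FiniteDimensional ℂ L] (hn2 : n ≠ 2)
    (htop : ⨆ i, gradedPiece x i = ⊤) {q : LieSubalgebra ℂ L}
    (hq : q.toSubmodule = upperPart x 0) : polar q = upperPart x 1 := by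
  have hmem : ∀ z, z ∈ polar q ↔ ∀ y ∈ upperPart x 0, killingForm ℂ L y z = 0 := fun z => by
    rw [polar, LinearMap.BilinForm.mem_orthogonal_iff, hq]
  have hxq : x ∈ upperPart x 0 := gradedPiece_le_upperPart x le_rfl (self_mem_gradedPiece x)
  have hinv : ∀ a b c, killingForm ℂ L ⁅a, b⁆ c = killingForm ℂ L a ⁅b, c⁆ := fun a b c => by
    rw [hρ.killingForm_eq, hρ.killingForm_eq, trace_map_lie_mul hρ]
  apply le_antisymm
  · refine (le_iSup_inf_gradedPiece htop fun z hz => ?_).trans (iSup_le fun i => ?_)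
    · rw [hmem] at hz ⊢
      intro y hy
      rw [← hinv]
      exact hz _ (by simpa using lie_mem_upperPart hy hxq)
    · rintro z ⟨hz, hzi⟩
      rcases le_or_gt 1 i with hi | hi
      · exact gradedPiece_le_upperPart x hi hzi
      have h := (hmem z).mp hz (hρ.adj z) (gradedPiece_le_upperPart x (by lia)
        (adj_mem_gradedPiece hρ hx hzi))
      rw [hρ.killingForm_eq, trace_mul_comm] at h
      have hn : (n : ℂ) - 2 ≠ 0 := sub_ne_zero.mpr (by exact_mod_cast hn2)
      have : z = 0 := hρ.eq_zero_of_trace_mul_adj z ((mul_eq_zero.mp h).resolve_left hn)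
      exact this ▸ zero_mem _
  · intro z hz
    rw [hmem]
    intro y hy
    refine upperPart_induction (p := fun y => killingForm ℂ L y z = 0) ?_ (by simp)
      (fun y y' h h' => by simp [h, h']) hy
    intro i hi y hy
    refine upperPart_induction (p := fun z => killingForm ℂ L y z = 0) ?_ (by simp)
      (fun y y' h h' => by simp [h, h']) hz
    intro j hj z hz
    have h := hinv y x z
    rw [← lie_skew, mem_gradedPiece.mp hy, mem_gradedPiece.mp hz] at h
    simp only [map_neg, LinearMap.neg_apply, map_smul, LinearMap.smul_apply, smul_eq_mul] at h
    have h' : (((i + j : ℤ) : ℂ) * Complex.I) * killingForm ℂ L y z = 0 := by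
      push_cast
      linear_combination -h
    refine (mul_eq_zero.mp h').resolve_left (mul_ne_zero ?_ Complex.I_ne_zero)
    exact_mod_cast (show i + j ≠ 0 by lia)

end Parabolic

/-! ### Eigenvalues of a canonical element -/

section Necessity

open Matrix

variable {n : ℕ} {A : Matrix (Fin n) (Fin n) ℝ} {L : Type*} [LieRing L] [LieAlgebra ℂ L]
  {ρ : L →ₗ[ℂ] Matrix (Fin n) (Fin n) ℂ} (hρ : IsSkewRealization ρ) {x : L}
  (hx : ρ x = A.map (fun t : ℝ => (t : ℂ)))

lemma wedge_mulVec_star_ne_zero {u v : Fin n → ℂ} (hu : u ≠ 0) (hv : v ∉ ℂ ∙ u) :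
    ρ (hρ.wedge u v) *ᵥ star u ≠ 0 := by
  intro h
  rw [hρ.wedge_mulVec, sub_eq_zero] at h
  apply hv
  rw [Submodule.mem_span_singleton]
  refine ⟨(u ⬝ᵥ star u)⁻¹ * (v ⬝ᵥ star u), ?_⟩
  rw [mul_smul, h, inv_smul_smul₀ (dotProduct_star_ne_zero hu)]

/-- Two vectors of a subspace, distinguished by the functional `t`, make its dimension at least
two. -/
lemma two_le_finrank_of_dotProduct {F : Submodule ℂ (Fin n → ℂ)} {p q t : Fin n → ℂ} (hp : p ∈ F)
    (hq : q ∈ F) (hp0 : p ≠ 0) (hpt : p ⬝ᵥ t = 0) (hqt : q ⬝ᵥ t ≠ 0) :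
    2 ≤ Module.finrank ℂ F := by
  have hli : LinearIndependent ℂ ![(⟨p, hp⟩ : F), ⟨q, hq⟩] := by
    rw [LinearIndependent.pair_iff]
    intro c d hcd
    have h : c • p + d • q = 0 := congrArg Subtype.val hcd
    have h' := congrArg (· ⬝ᵥ t) h
    simp only [add_dotProduct, smul_dotProduct, hpt, zero_dotProduct,
      smul_eq_mul, mul_zero, zero_add] at h'
    have hd := (mul_eq_zero.mp h').resolve_right hqt
    rw [hd, zero_smul, add_zero] at h
    exact ⟨(smul_eq_zero.mp h).resolve_right hp0, hd⟩
  simpa using hli.fintype_card_le_finrank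

/-- For `n > 2`, an `i a`-eigenvector `u` with `a > 0` can be completed by an independent
eigenvector whose eigenvalue is `i b` with `b ≥ 0`: otherwise `u` and its conjugate would span. -/
lemma exists_eigenvector_notMem_span (hA : Aᵀ = -A) (hn : 2 < n) (u : Fin n → ℂ) :
    ∃ b : ℝ, 0 ≤ b ∧ ∃ v ∈ imagEigenspace A b, v ∉ ℂ ∙ u := by
  by_contra! h
  have hle : (⊤ : Submodule ℂ (Fin n → ℂ)) ≤ Submodule.span ℂ {u, star u} := by
    rw [← iSup_imagEigenspace_eq_top hA]
    refine iSup_le fun b v hv => ?_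
    rcases le_or_gt 0 b with hb | hb
    · exact Submodule.span_mono (by simp) (h b hb v hv)
    · obtain ⟨c, hc⟩ := Submodule.mem_span_singleton.mp
        (h (-b) (by linarith) _ (star_mem_imagEigenspace hv))
      have hv' : v = star c • star u := by rw [← star_smul, hc, star_star]
      rw [hv']
      exact Submodule.smul_mem _ _ (Submodule.subset_span (by simp))
  classical
  have h2 := (finrank_span_finset_le_card (R := ℂ) ({u, star u} : Finset (Fin n → ℂ))).trans
    Finset.card_le_two
  rw [Finset.coe_pair, Set.finrank] at h2
  rw [top_le_iff.mp hle, finrank_top, Module.finrank_fin_fun] at h2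
  lia

lemma two_lt_of_imagEigenspace_ne_bot (hA : Aᵀ = -A) (hn2 : n ≠ 2) {a : ℝ} (ha : 0 < a)
    (h : imagEigenspace A a ≠ ⊥) : 2 < n := by
  obtain ⟨u, hu, hu0⟩ := Submodule.exists_mem_ne_zero_of_ne_bot h
  by_contra hn
  have hn' : n = 0 ∨ n = 1 := by lia
  rcases hn' with rfl | rfl
  · exact hu0 (Subsingleton.elim _ _)
  · have h0 := dotProduct_eq_zero_of_mem_imagEigenspace hA (by linarith : a + a ≠ 0) hu hu
    apply hu0
    ext i
    fin_cases i
    simpa [dotProduct] using h0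

include hρ hx

lemma exists_int_add_eq (hint : ∀ μ : ℂ, (LieAlgebra.ad ℂ L x).HasEigenvalue μ →
    ∃ m : ℤ, μ = (m : ℂ) * Complex.I) {a b : ℝ} {u v : Fin n → ℂ} (hu : u ∈ imagEigenspace A a)
    (hv : v ∈ imagEigenspace A b) (hu0 : u ≠ 0) (huv : v ∉ ℂ ∙ u) : ∃ m : ℤ, a + b = m := by
  have hne : hρ.wedge u v ≠ 0 := fun h => wedge_mulVec_star_ne_zero hρ hu0 huv (by simp [h])
  obtain ⟨m, hm⟩ := hint (((a + b : ℝ) : ℂ) * Complex.I)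
    (Module.End.hasEigenvalue_of_hasEigenvector ⟨Module.End.mem_eigenspace_iff.mpr
      (lie_wedge_eq_smul hρ hx hu hv), hne⟩)
  refine ⟨m, ?_⟩
  exact_mod_cast mul_right_cancel₀ Complex.I_ne_zero hm

lemma exists_int_add_eq_of_ne (hint : ∀ μ : ℂ, (LieAlgebra.ad ℂ L x).HasEigenvalue μ →
    ∃ m : ℤ, μ = (m : ℂ) * Complex.I) {a b : ℝ} (hab : a ≠ b) (ha : imagEigenspace A a ≠ ⊥)
    (hb : imagEigenspace A b ≠ ⊥) : ∃ m : ℤ, a + b = m := by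
  obtain ⟨u, hu, hu0⟩ := Submodule.exists_mem_ne_zero_of_ne_bot ha
  obtain ⟨v, hv, hv0⟩ := Submodule.exists_mem_ne_zero_of_ne_bot hb
  refine exists_int_add_eq hρ hx hint hu hv hu0 fun h => hv0 ?_
  exact imagEigenspace_disjoint hab ((Submodule.span_singleton_le_iff_mem _ _).mpr hu h) hv

/-- If `g_1` generates the positive part, then `g_1` does not annihilate the `-i a`-eigenspace
when `i a` is an eigenvalue with `a > 0`: otherwise the whole positive part would, but `u ∧ v` does
not annihilate the conjugate of `u`. -/
lemma exists_mulVec_ne_zero (hn2 : n ≠ 2) (hint : ∀ μ : ℂ,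
      (LieAlgebra.ad ℂ L x).HasEigenvalue μ → ∃ m : ℤ, μ = (m : ℂ) * Complex.I)
    (hgen : ∀ r : ℕ, gradedPiece x (r + 2) ≤
      bracketSpan (gradedPiece x 1) (gradedPiece x (r + 1)))
    {a : ℝ} (ha0 : 0 < a) (ha : imagEigenspace A a ≠ ⊥) :
    ∃ y ∈ gradedPiece x 1, ∃ t ∈ imagEigenspace A (-a), ρ y *ᵥ t ≠ 0 := by
  have hA := transpose_eq_neg_of_map_eq hρ hx
  by_contra! h
  have hall : ∀ r : ℕ, ∀ y ∈ gradedPiece x (r + 1), ∀ t ∈ imagEigenspace A (-a),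
      ρ y *ᵥ t = 0 := by
    intro r
    induction r with
    | zero => simpa using h
    | succ r ih =>
      intro y hy t ht
      have hy' := hgen r (by convert hy using 2; push_cast; ring)
      clear hy
      induction hy' using Submodule.span_induction with
      | mem y hy =>
        obtain ⟨p, hp, q, hq, rfl⟩ := hy
        rw [hρ.map_lie, sub_mulVec, ← mulVec_mulVec, ← mulVec_mulVec, ih q hq t ht, h p hp t ht]
        simp
      | zero => simp
      | add y z _ _ hy hz => rw [map_add, add_mulVec, hy, hz, add_zero]
      | smul c y _ hy => rw [map_smul, smul_mulVec, hy, smul_zero]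
  obtain ⟨u, hu, hu0⟩ := Submodule.exists_mem_ne_zero_of_ne_bot ha
  obtain ⟨b, hb, v, hv, huv⟩ :=
    exists_eigenvector_notMem_span hA (two_lt_of_imagEigenspace_ne_bot hA hn2 ha0 ha) u
  obtain ⟨m, hm⟩ := exists_int_add_eq hρ hx hint hu hv hu0 huv
  have hm0 : 0 < m := by
    have : (0 : ℝ) < m := by rw [← hm]; linarith
    exact_mod_cast this
  obtain ⟨r, rfl⟩ : ∃ r : ℕ, m = r + 1 := ⟨(m - 1).toNat, by lia⟩
  exact wedge_mulVec_star_ne_zero hρ hu0 huv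
    (hall r _ (wedge_mem_gradedPiece hρ hx hu hv hm) _ (star_mem_imagEigenspace hu))

lemma imagEigenspace_sub_one_ne_bot (hn2 : n ≠ 2) (hint : ∀ μ : ℂ,
      (LieAlgebra.ad ℂ L x).HasEigenvalue μ → ∃ m : ℤ, μ = (m : ℂ) * Complex.I)
    (hgen : ∀ r : ℕ, gradedPiece x (r + 2) ≤
      bracketSpan (gradedPiece x 1) (gradedPiece x (r + 1)))
    {a : ℝ} (ha0 : 0 < a) (ha : imagEigenspace A a ≠ ⊥) : imagEigenspace A (a - 1) ≠ ⊥ := by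
  obtain ⟨y, hy, t, ht, hyt⟩ := exists_mulVec_ne_zero hρ hx hn2 hint hgen ha0 ha
  have h := imagEigenspace_neg_ne_bot ((Submodule.ne_bot_iff _).mpr
    ⟨_, mulVec_mem_imagEigenspace hρ hx hy ht, hyt⟩)
  convert h using 2
  push_cast
  ring

lemma two_le_finrank_imagEigenspace_half (hn2 : n ≠ 2) (hint : ∀ μ : ℂ,
      (LieAlgebra.ad ℂ L x).HasEigenvalue μ → ∃ m : ℤ, μ = (m : ℂ) * Complex.I)
    (hgen : ∀ r : ℕ, gradedPiece x (r + 2) ≤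
      bracketSpan (gradedPiece x 1) (gradedPiece x (r + 1)))
    (ha : imagEigenspace A (1 / 2) ≠ ⊥) :
    2 ≤ Module.finrank ℂ (imagEigenspace A (1 / 2)) ∧
      2 ≤ Module.finrank ℂ (imagEigenspace A (-(1 / 2))) := by
  obtain ⟨y, hy, t, ht, hyt⟩ := exists_mulVec_ne_zero hρ hx hn2 hint hgen (by norm_num) ha
  have hmem : ρ y *ᵥ t ∈ imagEigenspace A (1 / 2) := by
    convert mulVec_mem_imagEigenspace hρ hx hy ht using 2
    norm_num
  have hstar : star t ∈ imagEigenspace A (1 / 2) := by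
    simpa using star_mem_imagEigenspace ht
  have ht0 : t ≠ 0 := by
    rintro rfl
    simp at hyt
  -- The matrix of `y` is skew, so `y t` is orthogonal to `t` for the bilinear form.
  have hskew : (ρ y *ᵥ t) ⬝ᵥ t = 0 := by
    have h : t ⬝ᵥ (ρ y *ᵥ t) = -((ρ y *ᵥ t) ⬝ᵥ t) := by
      rw [dotProduct_mulVec, ← mulVec_transpose, hρ.transpose_map, neg_mulVec, neg_dotProduct]
    rw [dotProduct_comm] at h
    exact self_eq_neg.mp h
  have htt := dotProduct_star_ne_zero ht0
  refine ⟨two_le_finrank_of_dotProduct hmem hstar hyt hskew (by rwa [dotProduct_comm]), ?_⟩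
  refine two_le_finrank_of_dotProduct (star_mem_imagEigenspace hmem) ht (star_ne_zero.mpr hyt)
    (t := star t) ?_ htt
  rw [star_dotProduct_star, dotProduct_comm, hskew, star_zero]

omit hρ hx in
/-- A finite symmetric set of reals that is closed under `a ↦ a - 1` at its positive elements, and
in which distinct elements have an integral sum, is an unbroken string of integers or of
half-integers. -/
lemma exists_eq_setOf_of_sub_one_mem {S : Set ℝ} (hfin : S.Finite) (hne : S.Nonempty)
    (hneg : ∀ a ∈ S, -a ∈ S) (hint : ∀ a ∈ S, ∀ b ∈ S, a ≠ b → ∃ m : ℤ, a + b = m)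
    (hsub : ∀ a ∈ S, 0 < a → a - 1 ∈ S) :
    ∃ c : ℝ, (c = 0 ∨ c = 1 / 2) ∧ ∃ k : ℕ,
      S = {a : ℝ | ∃ j : ℕ, j ≤ k ∧ (a = j + c ∨ a = -(j + c))} := by
  have hdesc : ∀ N : ℕ, ∀ a ∈ S, (N : ℝ) < a + 1 → a - N ∈ S := by
    intro N
    induction N with
    | zero => intro a ha _; simpa using ha
    | succ N ih =>
      intro a ha hN
      push_cast at hN ⊢
      have := hsub _ (ih a ha (by linarith)) (by linarith)
      convert this using 1
      ring
  have hhalf : ∀ a ∈ S, 0 < a → a < 1 → a = 1 / 2 := by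
    intro a ha h0 h1
    obtain ⟨m, hm⟩ := hint a ha (a - 1) (hsub a ha h0) (by linarith)
    have h2 : (-1 : ℝ) < m := by linarith
    have h3 : (m : ℝ) < 1 := by linarith
    have h4 : m = 0 := by
      have h2' : -1 < m := by exact_mod_cast h2
      have h3' : m < 1 := by exact_mod_cast h3
      lia
    rw [h4] at hm
    push_cast at hm
    linarith
  have hfract : ∀ a ∈ S, 0 ≤ a → ∃ N : ℕ, a - N ∈ S ∧ (a = N ∨ a = N + 1 / 2) := by
    intro a ha h0
    have h1 := Nat.floor_le h0
    have h2 := Nat.lt_floor_add_one a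
    have hmem := hdesc ⌊a⌋₊ a ha (by linarith)
    refine ⟨⌊a⌋₊, hmem, ?_⟩
    rcases h1.eq_or_lt with h | h
    · exact Or.inl h.symm
    · right
      have := hhalf _ hmem (by linarith) (by linarith)
      linarith
  obtain ⟨c, hc, hcS, hnat⟩ : ∃ c : ℝ, (c = 0 ∨ c = 1 / 2) ∧ c ∈ S ∧
      ∀ a ∈ S, 0 ≤ a → ∃ N : ℕ, a = N + c := by
    by_cases h0 : (0 : ℝ) ∈ S
    · refine ⟨0, Or.inl rfl, h0, fun a ha ha0 => ?_⟩
      obtain ⟨N, hN, rfl | rfl⟩ := hfract a ha ha0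
      · exact ⟨N, by simp⟩
      · exfalso
        obtain ⟨m, hm⟩ := hint _ hN 0 h0 (by simp)
        have : (1 : ℝ) = 2 * m := by linarith
        have : (1 : ℤ) = 2 * m := by exact_mod_cast this
        lia
    · have hall : ∀ a ∈ S, 0 ≤ a → (1 / 2 : ℝ) ∈ S ∧ ∃ N : ℕ, a = N + 1 / 2 := by
        intro a ha ha0
        obtain ⟨N, hN, rfl | rfl⟩ := hfract a ha ha0
        · exact absurd (by simpa using hN) h0
        · exact ⟨by simpa using hN, N, rfl⟩
      obtain ⟨a, ha⟩ := hne
      refine ⟨1 / 2, Or.inr rfl, ?_, fun a ha ha0 => (hall a ha ha0).2⟩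
      rcases le_total 0 a with h | h
      · exact (hall a ha h).1
      · exact (hall (-a) (hneg a ha) (by linarith)).1
  have hc0 : 0 ≤ c := by rcases hc with rfl | rfl <;> norm_num
  have hTfin : {N : ℕ | (N : ℝ) + c ∈ S}.Finite :=
    hfin.preimage (f := fun N : ℕ => (N : ℝ) + c) (by
      intro i _ j _ h
      simpa using h)
  obtain ⟨k, hk, hmax⟩ := hTfin.exists_maximal ⟨0, by simpa using hcS⟩
  have hmem : ∀ j : ℕ, j ≤ k → (j : ℝ) + c ∈ S := by
    intro j hj
    have := hdesc (k - j) _ hk (by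
      rw [Nat.cast_sub hj]
      have : (0 : ℝ) ≤ j := j.cast_nonneg
      linarith)
    rw [Nat.cast_sub hj] at this
    convert this using 1
    ring
  have hle : ∀ a ∈ S, 0 ≤ a → ∃ j : ℕ, j ≤ k ∧ a = j + c := by
    intro a ha ha0
    obtain ⟨j, rfl⟩ := hnat a ha ha0
    refine ⟨j, ?_, rfl⟩
    by_contra! h
    exact h.not_ge (hmax ha h.le)
  refine ⟨c, hc, k, ?_⟩
  ext a
  constructor
  · intro ha
    rcases le_total 0 a with h | h
    · obtain ⟨j, hj, hja⟩ := hle a ha h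
      exact ⟨j, hj, Or.inl hja⟩
    · obtain ⟨j, hj, hja⟩ := hle (-a) (hneg a ha) (by linarith)
      exact ⟨j, hj, Or.inr (by linarith)⟩
  · rintro ⟨j, hj, rfl | rfl⟩
    · exact hmem j hj
    · exact hneg _ (hmem j hj)

end Necessity

/-! ### Construction of the parabolic subalgebra -/

section Sufficiency

open Matrix

variable {n : ℕ} {A : Matrix (Fin n) (Fin n) ℝ} {L : Type*} [LieRing L] [LieAlgebra ℂ L]
  {ρ : L →ₗ[ℂ] Matrix (Fin n) (Fin n) ℂ} (hρ : IsSkewRealization ρ) {x : L}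
  (hx : ρ x = A.map (fun t : ℝ => (t : ℂ)))

/-- In a space of dimension at least two there is a nonzero vector that is orthogonal to a given
vector for the Hermitian form. -/
lemma exists_dotProduct_star_eq_zero {F : Submodule ℂ (Fin n → ℂ)} (v : Fin n → ℂ)
    (hF : 2 ≤ Module.finrank ℂ F) : ∃ w ∈ F, w ≠ 0 ∧ w ⬝ᵥ star v = 0 := by
  let f : F →ₗ[ℂ] ℂ :=
    { toFun := fun w => (w : Fin n → ℂ) ⬝ᵥ star v
      map_add' := fun _ _ => add_dotProduct _ _ _
      map_smul' := fun _ _ => smul_dotProduct _ _ _ }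
  have hker : LinearMap.ker f ≠ ⊥ := LinearMap.ker_ne_bot_of_finrank_lt (by
    rw [Module.finrank_self]
    lia)
  obtain ⟨w, hw, hw0⟩ := Submodule.exists_mem_ne_zero_of_ne_bot hker
  exact ⟨w, w.2, fun h => hw0 (Subtype.ext h), hw⟩

include hρ hx

/-- `u ∧ v` is a bracket of an element of `g_1`, that raises the eigenvalue `i (b - 1)` to `i b`,
with an element of the preceding graded piece. -/
lemma wedge_mem_bracketSpan_of_sub_one {a b : ℝ} {r : ℕ} {u v : Fin n → ℂ}
    (hu : u ∈ imagEigenspace A a) (hv : v ∈ imagEigenspace A b) (hab : a + b = r + 2)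
    (hb : imagEigenspace A (b - 1) ≠ ⊥) (hb2 : b ≠ 1 / 2) (hne : a ≠ b - 1) :
    hρ.wedge u v ∈ bracketSpan (gradedPiece x 1) (gradedPiece x (r + 1)) := by
  have hA := transpose_eq_neg_of_map_eq hρ hx
  obtain ⟨w, hw, hw0⟩ := Submodule.exists_mem_ne_zero_of_ne_bot hb
  have hws := star_mem_imagEigenspace hw
  have hr : (0 : ℝ) ≤ r := r.cast_nonneg
  have h1 : hρ.wedge v (star w) ∈ gradedPiece x 1 :=
    wedge_mem_gradedPiece hρ hx hv hws (by push_cast; ring)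
  have h2 : hρ.wedge u w ∈ gradedPiece x (r + 1) :=
    wedge_mem_gradedPiece hρ hx hu hw (by push_cast; linarith)
  have e1 : star w ⬝ᵥ u = 0 :=
    dotProduct_eq_zero_of_mem_imagEigenspace hA (fun h => hne (by linarith)) hws hu
  have e2 : v ⬝ᵥ u = 0 :=
    dotProduct_eq_zero_of_mem_imagEigenspace hA (by linarith) hv hu
  have e3 : v ⬝ᵥ w = 0 :=
    dotProduct_eq_zero_of_mem_imagEigenspace hA (fun h => hb2 (by linarith)) hv hw
  have h3 := lie_mem_bracketSpan h1 h2
  rw [hρ.lie_wedge, hρ.wedge_mulVec, hρ.wedge_mulVec, e1, e2, e3, zero_smul, zero_smul, sub_zero,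
    sub_zero, hρ.wedge_zero_left, zero_add, hρ.wedge_smul_right] at h3
  have hc : star w ⬝ᵥ w ≠ 0 := by
    rw [dotProduct_comm]
    exact dotProduct_star_ne_zero hw0
  exact (Submodule.smul_mem_iff _ hc).mp h3

/-- The exceptional weights `3/2` and `1/2`, where the raising element also moves `v`: it is
chosen, by means of a second vector of weight `1/2`, to annihilate `v`. -/
lemma wedge_mem_bracketSpan_of_half {r : ℕ} {u v : Fin n → ℂ}
    (hu : u ∈ imagEigenspace A (3 / 2)) (hv : v ∈ imagEigenspace A (1 / 2))
    (hr : (3 / 2 + 1 / 2 : ℝ) = r + 2) (hdim : 2 ≤ Module.finrank ℂ (imagEigenspace A (1 / 2))) :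
    hρ.wedge u v ∈ bracketSpan (gradedPiece x 1) (gradedPiece x (r + 1)) := by
  have hA := transpose_eq_neg_of_map_eq hρ hx
  obtain ⟨w, hw, hw0, hwv⟩ := exists_dotProduct_star_eq_zero v hdim
  have hws := star_mem_imagEigenspace hw
  have h1 : hρ.wedge u (star w) ∈ gradedPiece x 1 :=
    wedge_mem_gradedPiece hρ hx hu hws (by norm_num)
  have h2 : hρ.wedge w v ∈ gradedPiece x (r + 1) :=
    wedge_mem_gradedPiece hρ hx hw hv (by push_cast; linarith)
  have e1 : star w ⬝ᵥ v = 0 := by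
    have h := congrArg star hwv
    rwa [← star_dotProduct_star, star_star, star_zero, dotProduct_comm] at h
  have e2 : u ⬝ᵥ w = 0 :=
    dotProduct_eq_zero_of_mem_imagEigenspace hA (by norm_num) hu hw
  have e3 : u ⬝ᵥ v = 0 :=
    dotProduct_eq_zero_of_mem_imagEigenspace hA (by norm_num) hu hv
  have h3 := lie_mem_bracketSpan h1 h2
  rw [hρ.lie_wedge, hρ.wedge_mulVec, hρ.wedge_mulVec, e1, e2, e3, zero_smul, zero_smul, sub_zero,
    sub_zero, hρ.wedge_zero_right, add_zero, hρ.wedge_smul_left] at h3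
  have hc : star w ⬝ᵥ w ≠ 0 := by
    rw [dotProduct_comm]
    exact dotProduct_star_ne_zero hw0
  exact (Submodule.smul_mem_iff _ hc).mp h3

lemma wedge_mem_bracketSpan
    (hsub : ∀ a, 1 ≤ a → imagEigenspace A a ≠ ⊥ → imagEigenspace A (a - 1) ≠ ⊥)
    (hdim : imagEigenspace A (1 / 2) ≠ ⊥ → 2 ≤ Module.finrank ℂ (imagEigenspace A (1 / 2)))
    {a b : ℝ} {r : ℕ} {u v : Fin n → ℂ} (hu : u ∈ imagEigenspace A a)
    (hv : v ∈ imagEigenspace A b) (hu0 : u ≠ 0) (hv0 : v ≠ 0) (hab : a + b = r + 2) :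
    hρ.wedge u v ∈ bracketSpan (gradedPiece x 1) (gradedPiece x (r + 1)) := by
  wlog hle : b ≤ a generalizing a b u v
  · rw [hρ.wedge_swap]
    exact neg_mem (this hv hu hv0 hu0 (by linarith) (by linarith))
  have ha := (Submodule.ne_bot_iff _).mpr ⟨u, hu, hu0⟩
  have hb := (Submodule.ne_bot_iff _).mpr ⟨v, hv, hv0⟩
  have hr : (0 : ℝ) ≤ r := r.cast_nonneg
  rcases le_or_gt 1 b with hb1 | hb1
  · exact wedge_mem_bracketSpan_of_sub_one hρ hx hu hv hab (hsub b hb1 hb) (by linarith)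
      (by linarith)
  by_cases hba : b = a - 1
  · -- Here `r + 2 = 2 a - 1 = 2 b + 1 < 3`.
    have hr1 : (r : ℝ) < 1 := by linarith
    have hr0 : r = 0 := by
      have : r < 1 := by exact_mod_cast hr1
      lia
    have hr0' : (r : ℝ) = 0 := by exact_mod_cast hr0
    have ha' : a = 3 / 2 := by linarith
    have hb' : b = 1 / 2 := by linarith
    subst ha' hb'
    exact wedge_mem_bracketSpan_of_half hρ hx hu hv hab (hdim hb)
  · rw [hρ.wedge_swap]
    refine neg_mem (wedge_mem_bracketSpan_of_sub_one hρ hx hv hu (by linarith)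
      (hsub a (by linarith) ha) ?_ hba)
    intro h
    linarith

lemma iSup_gradedPiece_eq_top (hint : ∀ a b, imagEigenspace A a ≠ ⊥ → imagEigenspace A b ≠ ⊥ →
    ∃ m : ℤ, a + b = m) : ⨆ i, gradedPiece x i = ⊤ := by
  refine eq_top_of_wedge_mem hρ hx fun a b u hu v hv => ?_
  by_cases hu0 : u = 0
  · simp [hu0]
  by_cases hv0 : v = 0
  · simp [hv0]
  obtain ⟨m, hm⟩ := hint a b ((Submodule.ne_bot_iff _).mpr ⟨u, hu, hu0⟩)
    ((Submodule.ne_bot_iff _).mpr ⟨v, hv, hv0⟩)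
  exact Submodule.mem_iSup_of_mem m (wedge_mem_gradedPiece hρ hx hu hv hm)

lemma gradedPiece_le_bracketSpan
    (hint : ∀ a b, imagEigenspace A a ≠ ⊥ → imagEigenspace A b ≠ ⊥ → ∃ m : ℤ, a + b = m)
    (hsub : ∀ a, 1 ≤ a → imagEigenspace A a ≠ ⊥ → imagEigenspace A (a - 1) ≠ ⊥)
    (hdim : imagEigenspace A (1 / 2) ≠ ⊥ → 2 ≤ Module.finrank ℂ (imagEigenspace A (1 / 2)))
    (r : ℕ) :
    gradedPiece x (r + 2) ≤ bracketSpan (gradedPiece x 1) (gradedPiece x (r + 1)) := by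
  apply gradedPiece_le_of_le_sup
  · refine bracketSpan_le fun a ha b hb => ?_
    convert lie_mem_gradedPiece ha hb using 2
    ring
  refine le_top.trans (eq_top_of_wedge_mem hρ hx fun a b u hu v hv => ?_).ge
  by_cases hu0 : u = 0
  · simp [hu0]
  by_cases hv0 : v = 0
  · simp [hv0]
  obtain ⟨m, hm⟩ := hint a b ((Submodule.ne_bot_iff _).mpr ⟨u, hu, hu0⟩)
    ((Submodule.ne_bot_iff _).mpr ⟨v, hv, hv0⟩)
  by_cases hmr : m = r + 2
  · apply Submodule.mem_sup_left
    exact wedge_mem_bracketSpan hρ hx hsub hdim hu hv hu0 hv0 (by rw [hm, hmr]; push_cast; ring)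
  · apply Submodule.mem_sup_right
    exact Submodule.mem_iSup_of_mem m (Submodule.mem_iSup_of_mem hmr
      (wedge_mem_gradedPiece hρ hx hu hv hm))

/-- A real skew-symmetric matrix is canonical if its eigenvalues have pairwise integral sums, the
positive ones are joined to the interval `[0, 1)` by steps of length one, and the eigenvalue `i / 2`
is not simple. -/
lemma exists_isCanonicalElementOf [FiniteDimensional ℂ L] (hn2 : n ≠ 2)
    (hint : ∀ a b, imagEigenspace A a ≠ ⊥ → imagEigenspace A b ≠ ⊥ → ∃ m : ℤ, a + b = m)
    (hsub : ∀ a, 1 ≤ a → imagEigenspace A a ≠ ⊥ → imagEigenspace A (a - 1) ≠ ⊥)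
    (hdim : imagEigenspace A (1 / 2) ≠ ⊥ → 2 ≤ Module.finrank ℂ (imagEigenspace A (1 / 2))) :
    ∃ q : LieSubalgebra ℂ L, IsCanonicalElementOf x q := by
  have htop := iSup_gradedPiece_eq_top hρ hx hint
  let q : LieSubalgebra ℂ L :=
    { upperPart x 0 with
      lie_mem' := fun hy hz => by simpa using lie_mem_upperPart hy hz }
  have hq : q.toSubmodule = upperPart x 0 := rfl
  refine ⟨q, ⟨isParabolic_of_eq_upperPart hρ hx htop hq,
    fun μ hμ => hasEigenvalue_ad_of_iSup_eq_top htop hμ, hq, fun r => ?_⟩⟩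
  rw [polar_eq_upperPart_one hρ hx hn2 htop hq]
  exact descendingSeries_upperPart (gradedPiece_le_bracketSpan hρ hx hint hsub hdim) r

end Sufficiency

section Classification

variable {n : ℕ} {A : Matrix (Fin n) (Fin n) ℝ} {L : Type*} [LieRing L] [LieAlgebra ℂ L]
  {ρ : L →ₗ[ℂ] Matrix (Fin n) (Fin n) ℂ} (hρ : IsSkewRealization ρ) {x : L}
  (hx : ρ x = A.map (fun t : ℝ => (t : ℂ)))

lemma eigenvalueSet_eq_iff (hA : A.transpose = -A) (k : ℕ) (c : ℝ) :
    eigenvalueSet A = {μ : ℂ | ∃ j : ℕ, j ≤ k ∧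
        (μ = ((j : ℂ) + c) * Complex.I ∨ μ = -(((j : ℂ) + c) * Complex.I))} ↔
      {a : ℝ | imagEigenspace A a ≠ ⊥} =
        {a : ℝ | ∃ j : ℕ, j ≤ k ∧ (a = j + c ∨ a = -(j + c))} := by
  have hinj : ∀ a b : ℝ, (a : ℂ) * Complex.I = (b : ℂ) * Complex.I ↔ a = b := fun a b => by
    simp
  have hr : ∀ a : ℝ, ((a : ℂ) * Complex.I ∈ {μ : ℂ | ∃ j : ℕ, j ≤ k ∧
        (μ = ((j : ℂ) + c) * Complex.I ∨ μ = -(((j : ℂ) + c) * Complex.I))}) ↔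
      a ∈ {a : ℝ | ∃ j : ℕ, j ≤ k ∧ (a = j + c ∨ a = -(j + c))} := fun a => by
    refine exists_congr fun j => and_congr_right fun _ => ?_
    rw [← hinj a (j + c), ← hinj a (-(j + c))]
    push_cast
    rw [neg_mul]
  constructor
  · intro h
    ext a
    rw [← hr, ← h, mem_eigenvalueSet_iff hA]
    simp only [hinj, exists_eq_left', Set.mem_ofPred_eq]
  · intro h
    ext μ
    rw [mem_eigenvalueSet_iff hA]
    constructor
    · rintro ⟨a, rfl, ha⟩
      exact (hr a).mpr (h ▸ ha)
    · rintro ⟨j, hj, hμ⟩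
      have hμ' : ∃ a : ℝ, μ = (a : ℂ) * Complex.I := by
        rcases hμ with rfl | rfl
        · exact ⟨j + c, by push_cast; ring⟩
        · exact ⟨-(j + c), by push_cast; ring⟩
      obtain ⟨a, rfl⟩ := hμ'
      refine ⟨a, rfl, ?_⟩
      have : a ∈ {a : ℝ | imagEigenspace A a ≠ ⊥} := by
        rw [h, ← hr]
        exact ⟨j, hj, hμ⟩
      exact this

include hρ hx

lemma exists_setOf_imagEigenspace_eq (hn : 1 ≤ n) (hn2 : n ≠ 2)
    (hint : ∀ μ : ℂ, (LieAlgebra.ad ℂ L x).HasEigenvalue μ → ∃ m : ℤ, μ = (m : ℂ) * Complex.I)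
    (hgen : ∀ r : ℕ, gradedPiece x (r + 2) ≤
      bracketSpan (gradedPiece x 1) (gradedPiece x (r + 1))) :
    ∃ c : ℝ, (c = 0 ∨ c = 1 / 2) ∧ ∃ k : ℕ, {a : ℝ | imagEigenspace A a ≠ ⊥} =
      {a : ℝ | ∃ j : ℕ, j ≤ k ∧ (a = j + c ∨ a = -(j + c))} := by
  have hA := transpose_eq_neg_of_map_eq hρ hx
  apply exists_eq_setOf_of_sub_one_mem
  · refine (Module.End.finite_hasEigenvalue (complexEnd A)).preimage
      (f := fun a : ℝ => (a : ℂ) * Complex.I) ?_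
    intro a _ b _ h
    simpa using h
  · by_contra h
    rw [Set.not_nonempty_iff_eq_empty, Set.eq_empty_iff_forall_notMem] at h
    have hbot : ∀ a, imagEigenspace A a = ⊥ := fun a => not_not.mp (h a)
    have htop := iSup_imagEigenspace_eq_top hA
    simp only [hbot, iSup_bot] at htop
    have : Nonempty (Fin n) := ⟨⟨0, hn⟩⟩
    exact bot_ne_top htop
  · exact fun a ha => imagEigenspace_neg_ne_bot ha
  · exact fun a ha b hb hab => exists_int_add_eq_of_ne hρ hx hint hab ha hb
  · exact fun a ha ha0 => imagEigenspace_sub_one_ne_bot hρ hx hn2 hint hgen ha0 ha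

lemma exists_isCanonicalElementOf_of_setOf_eq [FiniteDimensional ℂ L] (hn2 : n ≠ 2) {c : ℝ}
    (hc : c = 0 ∨ c = 1 / 2) {k : ℕ} (hS : {a : ℝ | imagEigenspace A a ≠ ⊥} =
      {a : ℝ | ∃ j : ℕ, j ≤ k ∧ (a = j + c ∨ a = -(j + c))})
    (hdim : imagEigenspace A (1 / 2) ≠ ⊥ → 2 ≤ Module.finrank ℂ (imagEigenspace A (1 / 2))) :
    ∃ q : LieSubalgebra ℂ L, IsCanonicalElementOf x q := by
  have hmem : ∀ a, imagEigenspace A a ≠ ⊥ ↔ ∃ j : ℕ, j ≤ k ∧ (a = j + c ∨ a = -(j + c)) :=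
    fun a => Set.ext_iff.mp hS a
  obtain ⟨d, hd⟩ : ∃ d : ℤ, 2 * c = d := by
    rcases hc with rfl | rfl
    · exact ⟨0, by simp⟩
    · exact ⟨1, by simp⟩
  refine exists_isCanonicalElementOf hρ hx hn2 ?_ ?_ hdim
  · intro a b ha hb
    obtain ⟨i, -, rfl | rfl⟩ := (hmem a).mp ha <;> obtain ⟨j, -, rfl | rfl⟩ := (hmem b).mp hb
    · exact ⟨i + j + d, by push_cast; linarith⟩
    · exact ⟨i - j, by push_cast; ring⟩
    · exact ⟨j - i, by push_cast; ring⟩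
    · exact ⟨-(i + j + d), by push_cast; linarith⟩
  · intro a ha1 ha
    rw [hmem] at ha ⊢
    have hc1 : 0 ≤ c ∧ c < 1 := by rcases hc with rfl | rfl <;> norm_num
    obtain ⟨j, hj, rfl | rfl⟩ := ha
    · obtain _ | j := j
      · simp at ha1
        linarith
      · exact ⟨j, by lia, Or.inl (by push_cast; ring)⟩
    · have : (0 : ℝ) ≤ j := j.cast_nonneg
      linarith

end Classification

/-! ### The complexification of `so(n)` -/

section Complexification

open Matrix

variable {n : ℕ}

/-- The map from the complexification of `so(n)` to complex matrices that extends the inclusion of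
real skew-symmetric matrices. -/
noncomputable def complexifiedMatrix (n : ℕ) :
    ℂ ⊗[ℝ] (LieAlgebra.Orthogonal.so (Fin n) ℝ) →ₗ[ℂ] Matrix (Fin n) (Fin n) ℂ :=
  LinearMap.liftBaseChange ℂ
    { toFun := fun B : LieAlgebra.Orthogonal.so (Fin n) ℝ =>
        (B : Matrix (Fin n) (Fin n) ℝ).map (fun t : ℝ => (t : ℂ))
      map_add' := fun B C => by ext; simp
      map_smul' := fun r B => by ext; simp }

lemma complexifiedMatrix_tmul (c : ℂ) (B : LieAlgebra.Orthogonal.so (Fin n) ℝ) :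
    complexifiedMatrix n (c ⊗ₜ B) =
      c • (B : Matrix (Fin n) (Fin n) ℝ).map (fun t : ℝ => (t : ℂ)) :=
  LinearMap.liftBaseChange_tmul _ _ _ _

lemma exists_eq_add_I_tmul (z : ℂ ⊗[ℝ] (LieAlgebra.Orthogonal.so (Fin n) ℝ)) :
    ∃ B C : LieAlgebra.Orthogonal.so (Fin n) ℝ,
      z = (1 : ℂ) ⊗ₜ[ℝ] B + Complex.I ⊗ₜ[ℝ] C := by
  induction z using TensorProduct.induction_on with
  | zero => exact ⟨0, 0, by simp⟩
  | tmul c B =>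
    refine ⟨c.re • B, c.im • B, ?_⟩
    rw [← TensorProduct.smul_tmul, ← TensorProduct.smul_tmul, ← TensorProduct.add_tmul]
    congr 1
    apply Complex.ext <;> simp
  | add y z hy hz =>
    obtain ⟨B, C, rfl⟩ := hy
    obtain ⟨B', C', rfl⟩ := hz
    refine ⟨B + B', C + C', ?_⟩
    rw [TensorProduct.tmul_add, TensorProduct.tmul_add]
    abel

lemma complexifiedMatrix_lie (y z : ℂ ⊗[ℝ] (LieAlgebra.Orthogonal.so (Fin n) ℝ)) :
    complexifiedMatrix n ⁅y, z⁆ = complexifiedMatrix n y * complexifiedMatrix n z -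
      complexifiedMatrix n z * complexifiedMatrix n y := by
  induction y using TensorProduct.induction_on with
  | zero => simp
  | add y y' hy hy' =>
    rw [add_lie, map_add, hy, hy', map_add]
    noncomm_ring
  | tmul c B =>
    induction z using TensorProduct.induction_on with
    | zero =>
      have h := lie_zero (L := ℂ ⊗[ℝ] (LieAlgebra.Orthogonal.so (Fin n) ℝ))
        (M := ℂ ⊗[ℝ] (LieAlgebra.Orthogonal.so (Fin n) ℝ)) (c ⊗ₜ[ℝ] B)
      simp [h]
    | add y y' hy hy' =>
      have h := lie_add (L := ℂ ⊗[ℝ] (LieAlgebra.Orthogonal.so (Fin n) ℝ)) (c ⊗ₜ[ℝ] B) y y'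
      rw [h, map_add, hy, hy', map_add]
      noncomm_ring
    | tmul d C =>
      have hlie : ((⁅B, C⁆ : LieAlgebra.Orthogonal.so (Fin n) ℝ) : Matrix (Fin n) (Fin n) ℝ) =
          B * C - C * B := rfl
      rw [LieAlgebra.ExtendScalars.bracket_tmul, complexifiedMatrix_tmul, complexifiedMatrix_tmul,
        complexifiedMatrix_tmul, hlie]
      have hmul : ∀ P Q : Matrix (Fin n) (Fin n) ℝ, (P * Q).map (fun t : ℝ => (t : ℂ)) =
          P.map (fun t : ℝ => (t : ℂ)) * Q.map (fun t : ℝ => (t : ℂ)) := fun P Q =>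
        Matrix.map_mul (f := Complex.ofRealHom)
      have hsub : ∀ P Q : Matrix (Fin n) (Fin n) ℝ, (P - Q).map (fun t : ℝ => (t : ℂ)) =
          P.map (fun t : ℝ => (t : ℂ)) - Q.map (fun t : ℝ => (t : ℂ)) := fun P Q => by
        ext
        simp
      rw [hsub, hmul, hmul, smul_mul_smul_comm, smul_mul_smul_comm, smul_sub, mul_comm d c]

lemma isSkewRealization_complexifiedMatrix (n : ℕ) :
    IsSkewRealization (complexifiedMatrix n) where
  map_lie := complexifiedMatrix_lie
  injective := by
    rw [injective_iff_map_eq_zero]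
    intro z hz
    obtain ⟨B, C, rfl⟩ := exists_eq_add_I_tmul z
    rw [map_add, complexifiedMatrix_tmul, complexifiedMatrix_tmul] at hz
    have hentry := fun i j => congrFun (congrFun hz i) j
    have hB : B = 0 := by
      ext i j
      simpa using congrArg Complex.re (hentry i j)
    have hC : C = 0 := by
      ext i j
      simpa using congrArg Complex.im (hentry i j)
    simp [hB, hC]
  range := fun M => by
    constructor
    · rintro ⟨z, rfl⟩
      obtain ⟨B, C, rfl⟩ := exists_eq_add_I_tmul z
      have h : ∀ D : LieAlgebra.Orthogonal.so (Fin n) ℝ,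
          ((D : Matrix (Fin n) (Fin n) ℝ).map (fun t : ℝ => (t : ℂ)))ᵀ =
            -(D : Matrix (Fin n) (Fin n) ℝ).map (fun t : ℝ => (t : ℂ)) := fun D =>
        transpose_map_ofReal ((LieAlgebra.Orthogonal.mem_so _ _ _).mp D.2)
      rw [map_add, complexifiedMatrix_tmul, complexifiedMatrix_tmul, transpose_add,
        transpose_smul, transpose_smul, h, h]
      simp only [smul_neg]
      abel
    · intro hM
      have hentry := fun i j => congrFun (congrFun hM i) j
      have hre : M.map Complex.re ∈ LieAlgebra.Orthogonal.so (Fin n) ℝ := by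
        rw [LieAlgebra.Orthogonal.mem_so]
        ext i j
        simpa using congrArg Complex.re (hentry i j)
      have him : M.map Complex.im ∈ LieAlgebra.Orthogonal.so (Fin n) ℝ := by
        rw [LieAlgebra.Orthogonal.mem_so]
        ext i j
        simpa using congrArg Complex.im (hentry i j)
      refine ⟨(1 : ℂ) ⊗ₜ ⟨_, hre⟩ + Complex.I ⊗ₜ ⟨_, him⟩, ?_⟩
      rw [map_add, complexifiedMatrix_tmul, complexifiedMatrix_tmul]
      ext i j
      apply Complex.ext <;> simp

end Complexification

end CanonicalElement

open CanonicalElement in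
theorem proposition3 (n : ℕ) (hn : 1 ≤ n) (hn2 : n ≠ 2)
    (ξ : LieAlgebra.Orthogonal.so (Fin n) ℝ) :
    CanonicalElement.IsCanonical ξ ↔
      (∃ k : ℕ, CanonicalElement.eigenvalueSet (ξ : Matrix (Fin n) (Fin n) ℝ) =
        {μ : ℂ | ∃ j : ℕ, j ≤ k ∧
          (μ = (j : ℂ) * Complex.I ∨ μ = -((j : ℂ) * Complex.I))}) ∨
      (∃ k : ℕ, CanonicalElement.eigenvalueSet (ξ : Matrix (Fin n) (Fin n) ℝ) =
          {μ : ℂ | ∃ j : ℕ, j ≤ k ∧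
            (μ = ((j : ℂ) + 1 / 2) * Complex.I ∨ μ = -(((j : ℂ) + 1 / 2) * Complex.I))} ∧
        2 ≤ CanonicalElement.multiplicity (ξ : Matrix (Fin n) (Fin n) ℝ) ((1 / 2 : ℂ) * Complex.I) ∧
        2 ≤ CanonicalElement.multiplicity (ξ : Matrix (Fin n) (Fin n) ℝ)
          (-((1 / 2 : ℂ) * Complex.I))) := by
  have hρ := isSkewRealization_complexifiedMatrix n
  have hx : complexifiedMatrix n ((1 : ℂ) ⊗ₜ[ℝ] ξ) =
      (ξ : Matrix (Fin n) (Fin n) ℝ).map (fun t : ℝ => (t : ℂ)) := by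
    rw [complexifiedMatrix_tmul, one_smul]
  have hA := transpose_eq_neg_of_map_eq hρ hx
  have h0 := fun k => eigenvalueSet_eq_iff hA k 0
  have h1 := fun k => eigenvalueSet_eq_iff hA k (1 / 2)
  have hhalf : ((1 / 2 : ℝ) : ℂ) = 1 / 2 := by norm_num
  have hm : CanonicalElement.multiplicity (ξ : Matrix (Fin n) (Fin n) ℝ) ((1 / 2 : ℂ) * Complex.I) =
      Module.finrank ℂ (imagEigenspace (ξ : Matrix (Fin n) (Fin n) ℝ) (1 / 2)) := by
    rw [CanonicalElement.multiplicity, imagEigenspace, hhalf]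
  have hm' : CanonicalElement.multiplicity (ξ : Matrix (Fin n) (Fin n) ℝ) (-((1 / 2 : ℂ) * Complex.I)) =
      Module.finrank ℂ (imagEigenspace (ξ : Matrix (Fin n) (Fin n) ℝ) (-(1 / 2))) := by
    rw [CanonicalElement.multiplicity, imagEigenspace, Complex.ofReal_neg, hhalf, neg_mul]
  simp only [Complex.ofReal_zero, add_zero] at h0
  simp only [Complex.ofReal_div, Complex.ofReal_one, Complex.ofReal_ofNat] at h1
  rw [hm, hm']
  simp only [h0, h1]
  constructor
  · rintro ⟨q, hq⟩
    have hgen := gradedPiece_succ_le_bracketSpan (N := polar q) hq.series_eq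
    obtain ⟨c, rfl | rfl, k, hk⟩ :=
      exists_setOf_imagEigenspace_eq hρ hx hn hn2 hq.integral hgen
    · left
      exact ⟨k, by simpa only [add_zero] using hk⟩
    · right
      refine ⟨k, hk, two_le_finrank_imagEigenspace_half hρ hx hn2 hq.integral hgen ?_⟩
      have : (1 / 2 : ℝ) ∈ {a : ℝ | imagEigenspace (ξ : Matrix (Fin n) (Fin n) ℝ) a ≠ ⊥} := by
        rw [hk]
        exact ⟨0, Nat.zero_le _, Or.inl (by simp)⟩
      exact this
  · rintro (⟨k, hk⟩ | ⟨k, hk, hdim, -⟩)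
    · refine exists_isCanonicalElementOf_of_setOf_eq hρ hx hn2 (c := 0) (Or.inl rfl) (k := k)
        (by simpa only [add_zero] using hk) fun h => ?_
      -- All eigenvalues are integral multiples of `i`, so `i / 2` is not one of them.
      exfalso
      have : (1 / 2 : ℝ) ∈ {a : ℝ | imagEigenspace (ξ : Matrix (Fin n) (Fin n) ℝ) a ≠ ⊥} := h
      rw [hk] at this
      obtain ⟨j, -, hj | hj⟩ := this
      · have h2 : (1 : ℝ) = 2 * j := by linarith
        have h3 : 1 = 2 * j := by exact_mod_cast h2
        lia
      · have : (0 : ℝ) ≤ j := j.cast_nonneg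
        linarith
    · exact exists_isCanonicalElementOf_of_setOf_eq hρ hx hn2 (Or.inr rfl) hk fun _ => hdim
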